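/- Let $(M,g)$ be a smooth finite-dimensional Riemannian manifold (without boundary) with Levi-Civita connection $\nabla$ and curvature $\mathfrak R(X,Y)Z=\nabla_X\nabla_YZ-\nabla_Y\nabla_XZ-\nabla_{[X,Y]}Z$. Let $\pi:TM\to M$ be the projection, and let $K_{(p,u)}:T_{(p,u)}TM\to T_pM$ be the connection map of $\nabla$, i.e. the linear map with $K(d\sigma_p(w))=\nabla_w\sigma$ for every $w\in T_pM$ and every vector field $\sigma$ on $M$ with $\sigma(p)=u$, and $K\big(\tfrac{d}{dt}\big|_{t=0}(p,u+ta)\big)=a$ for every $a\in T_pM$. For a vector field $X$ on $M$, its horizontal lift $X^h$ and vertical lift $X^v$ are the vector fields on $TM$ determined by $d\pi(X^h)=X$, $K(X^h)=0$ and $d\pi(X^v)=0$, $K(X^v)=X$. Let $m_1,m_2,m_3\in\mathbb R$ with $m_1>0$, $m_3>0$ and $m_1m_3-m_2^2>0$, and equip $TM$ with the metric $\bar g$ given by $$\bar g(X^h,Y^h)=m_1g(X,Y),\qquad \bar g(X^h,Y^v)=m_2g(X,Y),\qquad \bar g(X^v,Y^v)=m_3g(X,Y).$$ Let $\bar\nabla$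 be the Levi-Civita connection of $(TM,\bar g)$. Then for all smooth vector fields $X,Y$ on $M$ and every $(p,u)\in TM$, the following hold at $(p,u)$: 1. $d\pi(\bar\nabla_{X^h}Y^h)=\nabla_XY+\frac{1}{m_1m_3-m_2^2}\Big(m_2m_3\,\mathfrak R(u,X)Y+\frac{m_2m_3}{2}\mathfrak R(X,Y)u\Big)$ 2. $K(\bar\nabla_{X^h}Y^h)=\frac{1}{m_1m_3-m_2^2}\Big(-m_2^2\,\mathfrak R(u,X)Y-\frac{m_1m_3}{2}\mathfrak R(X,Y)u\Big)$ 3. $d\pi(\bar\nabla_{X^h}Y^v)=\frac{1}{m_1m_3-m_2^2}\cdot\frac{m_3^2}{2}\mathfrak R(u,Y)X$ 4. $K(\bar\nabla_{X^h}Y^v)=\nabla_XY-\frac{1}{m_1m_3-m_2^2}\cdot\frac{m_2m_3}{2}\mathfrak R(u,Y)X$ 5. $d\pi(\bar\nabla_{X^v}Y^h)=\frac{1}{m_1m_3-m_2^2}\cdot\frac{m_3^2}{2}\mathfrak R(u,X)Y$ 6. $K(\bar\nabla_{X^v}Y^h)=-\frac{1}{m_1m_3-m_2^2}\cdot\frac{m_2m_3}{2}\mathfrak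 R(u,X)Y$ 7. $d\pi(\bar\nabla_{X^v}Y^v)=0$ 8. $K(\bar\nabla_{X^v}Y^v)=0$ -/

import Mathlib

open Bundle Manifold
open scoped ContDiff Topology

noncomputable section

namespace TangentMetric

variable {E : Type*} [NormedAddCommGroup E] [NormedSpace ℝ E]
  {H : Type*} [TopologicalSpace H] {I : ModelWithCorners ℝ E H}
  {M : Type*} [TopologicalSpace M] [ChartedSpace H M]

/-- A covariant derivative `cov` on the tangent bundle of a manifold (recall that `cov Y x v` is
`(∇_v Y)(x)`) is a Levi-Civita connection of the metric `g`, given as a field of bilinear forms: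
it is torsion free and compatible with `g`, that is, `v g(Y, Z) = g(∇_v Y, Z) + g(Y, ∇_v Z)`. -/
structure IsLeviCivita [FiniteDimensional ℝ E] [IsManifold I 2 M]
    (g : Π x : M, TangentSpace I x →L[ℝ] TangentSpace I x →L[ℝ] ℝ)
    (cov : CovariantDerivative I E (TangentSpace I : M → Type _)) : Prop where
  torsion_eq_zero : haveI := FiniteDimensional.complete ℝ E; cov.torsion = 0
  compatible : ∀ {x : M} {Y Z : Π x : M, TangentSpace I x},
    MDifferentiableAt I I.tangent (fun y ↦ (⟨y, Y y⟩ : TangentBundle I M)) x →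
    MDifferentiableAt I I.tangent (fun y ↦ (⟨y, Z y⟩ : TangentBundle I M)) x →
    ∀ v : TangentSpace I x,
      mvfderiv I (fun y ↦ g y (Y y) (Z y)) x v =
        g x (cov Y x v) (Z x) + g x (Y x) (cov Z x v)

section Curvature

variable [IsManifold I 1 M]

/-- The curvature `R(X, Y)Z = ∇_X ∇_Y Z - ∇_Y ∇_X Z - ∇_{[X, Y]} Z` on vector fields. -/
def curvatureField (cov : CovariantDerivative I E (TangentSpace I : M → Type _))
    (X Y Z : Π x : M, TangentSpace I x) (x : M) : TangentSpace I x :=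
  cov (fun y ↦ cov Z y (Y y)) x (X x) - cov (fun y ↦ cov Z y (X y)) x (Y x)
    - cov Z x (VectorField.mlieBracket I X Y x)

/-- The curvature tensor `R_x(a, b)c` on tangent vectors: the value at `x` of the curvature on
vector fields that extend `a`, `b`, `c` and are smooth near `x`
(those with constant components in the preferred chart at `x`). -/
def curvature (cov : CovariantDerivative I E (TangentSpace I : M → Type _)) (x : M)
    (a b c : TangentSpace I x) : TangentSpace I x :=
  curvatureField cov (FiberBundle.extend E a) (FiberBundle.extend E b) (FiberBundle.extend E c) x

end Curvature

section Splitting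

variable [IsManifold I 1 M]

variable (I) in
/-- The differential `dπ` of the projection `π : TM → M` at `P`. -/
def dproj (P : TangentBundle I M) : TangentSpace I.tangent P →L[ℝ] TangentSpace I P.1 :=
  mfderiv I.tangent I (TotalSpace.proj : TangentBundle I M → M) P

variable (I) in
/-- The fibre component `du ∈ T_x M` of a tangent vector `(dx, du)` to `TM` at `P = (x, u)`, in the
chart of `TM` induced by the preferred chart of `M` at `x`. -/
def fibreComponent (P : TangentBundle I M) : TangentSpace I.tangent P →L[ℝ] TangentSpace I P.1 :=
  ContinuousLinearMap.snd ℝ E E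

/-- The connection map `K : T_P TM → T_x M` of a connection at `P = (x, u)`: in the chart of `TM`
induced by the preferred chart of `M` at `x`, it sends `(dx, du)` to `du + Γ_x(dx, u)`, where
`Γ_x(w, u) = ∇_w U` for the vector field `U` through `u` with constant components in that chart.
Equivalently, `K (dσ(w)) = ∇_w σ` for every vector field `σ` through `u`:
see `connectionMap_mfderiv` and `connectionMap_vertical` below. -/
def connectionMap (cov : CovariantDerivative I E (TangentSpace I : M → Type _))
    (P : TangentBundle I M) : TangentSpace I.tangent P →L[ℝ] TangentSpace I P.1 :=
  fibreComponent I P + (cov (FiberBundle.extend E P.2) P.1).comp (dproj I P)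

/-- The tangent vector to `TM` at `P` with horizontal component `a` and vertical component `b`;
see `dproj_lift`, `connectionMap_lift` and `eq_lift` below. -/
def lift (cov : CovariantDerivative I E (TangentSpace I : M → Type _))
    (P : TangentBundle I M) (a b : TangentSpace I P.1) : TangentSpace I.tangent P :=
  ((a, b - cov (FiberBundle.extend E P.2) P.1 a) : E × E)

/-- The horizontal lift `X^h` of a vector field `X`, a vector field on `TM`:
`dπ(X^h) = X` and `K(X^h) = 0`. -/
def hlift (cov : CovariantDerivative I E (TangentSpace I : M → Type _))
    (X : Π x : M, TangentSpace I x) (P : TangentBundle I M) : TangentSpace I.tangent P :=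
  lift cov P (X P.1) 0

/-- The vertical lift `X^v` of a vector field `X`, a vector field on `TM`:
`dπ(X^v) = 0` and `K(X^v) = X`. -/
def vlift (cov : CovariantDerivative I E (TangentSpace I : M → Type _))
    (X : Π x : M, TangentSpace I x) (P : TangentBundle I M) : TangentSpace I.tangent P :=
  lift cov P 0 (X P.1)

/-- The bilinear form `(ξ, η) ↦ b (A ξ) (B η)` on the tangent space of `TM` at `P`. -/
def pullForm {P : TangentBundle I M} (b : TangentSpace I P.1 →L[ℝ] TangentSpace I P.1 →L[ℝ] ℝ)
    (A B : TangentSpace I.tangent P →L[ℝ] TangentSpace I P.1) :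
    TangentSpace I.tangent P →L[ℝ] TangentSpace I.tangent P →L[ℝ] ℝ :=
  ((ContinuousLinearMap.precomp ℝ B).comp b).comp A

/-- The metric on `TM` with weights `m₁`, `m₂`, `m₃`, as a field of bilinear forms:
`m₁ g(dπ ξ, dπ η) + m₂ (g(dπ ξ, K η) + g(K ξ, dπ η)) + m₃ g(K ξ, K η)`;
see `metric_hlift_hlift`, `metric_hlift_vlift` and `metric_vlift_vlift` below. -/
def metric (g : Π x : M, TangentSpace I x →L[ℝ] TangentSpace I x →L[ℝ] ℝ)
    (cov : CovariantDerivative I E (TangentSpace I : M → Type _)) (m₁ m₂ m₃ : ℝ)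
    (P : TangentBundle I M) :
    TangentSpace I.tangent P →L[ℝ] TangentSpace I.tangent P →L[ℝ] ℝ :=
  m₁ • pullForm (g P.1) (dproj I P) (dproj I P)
    + m₂ • (pullForm (g P.1) (dproj I P) (connectionMap cov P)
      + pullForm (g P.1) (connectionMap cov P) (dproj I P))
    + m₃ • pullForm (g P.1) (connectionMap cov P) (connectionMap cov P)

/-! Sanity checks: the defining properties of the connection map, the lifts and the metric. -/

theorem dproj_apply (P : TangentBundle I M) (ξ : TangentSpace I.tangent P) :
    dproj I P ξ = (show E × E from ξ).1 := by
  have h : HasMFDerivAt I.tangent I (TotalSpace.proj : TangentBundle I M → M) P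
      (ContinuousLinearMap.fst ℝ E E) := by
    refine ⟨(FiberBundle.continuous_proj E (TangentSpace I : M → Type _)).continuousAt, ?_⟩
    have key : ∀ z ∈ (extChartAt I.tangent P).target,
        writtenInExtChartAt I.tangent I P (TotalSpace.proj : TangentBundle I M → M) z = z.1 := by
      intro z hz
      have h1 := (extChartAt I.tangent P).right_inv hz
      exact congrArg Prod.fst h1
    refine (hasFDerivWithinAt_fst (𝕜 := ℝ) (E := E) (F := E)).congr_of_eventuallyEq ?_ ?_
    · filter_upwards [extChartAt_target_mem_nhdsWithin (I := I.tangent) P] with z hz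
      exact key z hz
    · exact key _ (mem_extChartAt_target P)
  exact congrArg (fun L : TangentSpace I.tangent P →L[ℝ] TangentSpace I P.1 ↦ L ξ) h.mfderiv

theorem trivializationAt_self (x : M) (v : TangentSpace I x) :
    (trivializationAt E (TangentSpace I) x (⟨x, v⟩ : TangentBundle I M)).2 = v :=
  tangentCoordChange_self (I := I) (mem_extChartAt_source x)

theorem fibreComponent_mfderiv {E' : Type*} [NormedAddCommGroup E'] [NormedSpace ℝ E']
    {H' : Type*} [TopologicalSpace H'] {J : ModelWithCorners ℝ E' H'}
    {N : Type*} [TopologicalSpace N] [ChartedSpace H' N] {f : N → TangentBundle I M} {n : N}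
    (hf : MDifferentiableAt J I.tangent f n) (v : TangentSpace J n) :
    fibreComponent I (f n) (mfderiv J I.tangent f n v) =
      mvfderiv J (fun y ↦ (trivializationAt E (TangentSpace I) (f n).1 (f y)).2) n v := by
  have h := hf.hasMFDerivAt
  have h' : HasMFDerivAt J 𝓘(ℝ, E)
      (fun y ↦ (trivializationAt E (TangentSpace I) (f n).1 (f y)).2) n
      ((fibreComponent I (f n)).comp (mfderiv J I.tangent f n)) := by
    refine ⟨?_, ?_⟩
    · exact ((mdifferentiableAt_totalSpace I f).1 hf).2.continuousAt
    · exact (hasFDerivAt_snd (𝕜 := ℝ) (E := E) (F := E)).comp_hasFDerivWithinAt _ h.2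
  exact (congrArg (fun L : TangentSpace J n →L[ℝ] E ↦ L v) h'.mfderiv).symm

theorem dproj_lift (cov : CovariantDerivative I E (TangentSpace I : M → Type _))
    (P : TangentBundle I M) (a b : TangentSpace I P.1) : dproj I P (lift cov P a b) = a :=
  dproj_apply P _

theorem connectionMap_lift (cov : CovariantDerivative I E (TangentSpace I : M → Type _))
    (P : TangentBundle I M) (a b : TangentSpace I P.1) :
    connectionMap cov P (lift cov P a b) = b := by
  have h : connectionMap cov P (lift cov P a b) = fibreComponent I P (lift cov P a b)
    + cov (FiberBundle.extend E P.2) P.1 (dproj I P (lift cov P a b)) := rfl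
  rw [h, dproj_lift]
  exact sub_add_cancel b _

theorem eq_lift (cov : CovariantDerivative I E (TangentSpace I : M → Type _))
    (P : TangentBundle I M) (ξ : TangentSpace I.tangent P) :
    ξ = lift cov P (dproj I P ξ) (connectionMap cov P ξ) := by
  have h : connectionMap cov P ξ = fibreComponent I P ξ
    + cov (FiberBundle.extend E P.2) P.1 (dproj I P ξ) := rfl
  refine Prod.ext (dproj_apply P ξ).symm ?_
  change fibreComponent I P ξ = connectionMap cov P ξ - _
  rw [h]
  exact (add_sub_cancel_right _ _).symm

/-- On a fixed tangent space, the difference of the covariant derivative and of the derivative of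
the components in the preferred chart only depends on the value of the vector field. -/
theorem cov_eq_add_mvfderiv [FiniteDimensional ℝ E]
    [ContMDiffVectorBundle 1 E (TangentSpace I : M → Type _) I]
    (cov : CovariantDerivative I E (TangentSpace I : M → Type _))
    {σ : Π x : M, TangentSpace I x} {x : M}
    (hσ : MDifferentiableAt I I.tangent (fun y ↦ (⟨y, σ y⟩ : TangentBundle I M)) x)
    (w : TangentSpace I x) :
    cov σ x w = (show TangentSpace I x from mvfderiv I (fun y ↦
        (trivializationAt E (TangentSpace I) x (⟨y, σ y⟩ : TangentBundle I M)).2) x w)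
      + cov (FiberBundle.extend E (σ x)) x w := by
  let T : (Π y : M, TangentSpace I y) → M → E := fun τ y ↦
    (trivializationAt E (TangentSpace I) x (⟨y, τ y⟩ : TangentBundle I M)).2
  have hT {τ : Π y : M, TangentSpace I y}
      (hτ : MDifferentiableAt I I.tangent (fun y ↦ (⟨y, τ y⟩ : TangentBundle I M)) x) :
      MDifferentiableAt I 𝓘(ℝ, E) (T τ) x :=
    ((mdifferentiableAt_totalSpace I (fun y ↦ (⟨y, τ y⟩ : TangentBundle I M))).1 hτ).2
  let D : (Π y : M, TangentSpace I y) → Π y : M, TangentSpace I y →L[ℝ] TangentSpace I y :=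
    fun τ y ↦ (mvfderiv I (T τ) y : TangentSpace I y →L[ℝ] E)
  have hD : IsCovariantDerivativeOn E D {x} := by
    refine ⟨fun {τ τ' y} hτ hτ' hy ↦ ?_, fun {τ f y} hτ hf hy ↦ ?_⟩
    · obtain rfl : y = x := hy
      have h1 : T (τ + τ') = T τ + T τ' := funext fun z ↦ map_add (fderivWithin ℝ
        ((chartAt H y).extend I ∘ ((chartAt H z).extend I).symm) (Set.range I)
        ((chartAt H z).extend I z)) _ _
      change mvfderiv I (T (τ + τ')) y = mvfderiv I (T τ) y + mvfderiv I (T τ') y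
      rw [h1, mvfderiv_add (hT hτ) (hT hτ')]
    · obtain rfl : y = x := hy
      have h1 : T (f • τ) = f • T τ := funext fun z ↦ map_smul (fderivWithin ℝ
        ((chartAt H y).extend I ∘ ((chartAt H z).extend I).symm) (Set.range I)
        ((chartAt H z).extend I z)) _ _
      have h2 : T τ y = τ y := trivializationAt_self y (τ y)
      change mvfderiv I (T (f • τ)) y = f y • mvfderiv I (T τ) y
        + (mvfderiv I f y).smulRight (show E from τ y)
      rw [h1, mvfderiv_smul hf (hT hτ), h2]
  have hc : IsCovariantDerivativeOn E cov.toFun {x} := cov.isCovariantDerivativeOn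
  have he : MDifferentiableAt I I.tangent
      (fun y ↦ (⟨y, FiberBundle.extend E (σ x) y⟩ : TangentBundle I M)) x :=
    FiberBundle.mdifferentiableAt_extend I E (σ x)
  have hx : x ∈ ({x} : Set M) := rfl
  have e1 := IsCovariantDerivativeOn.difference_apply hc hD hx hσ
  have e2 := IsCovariantDerivativeOn.difference_apply hc hD hx he
  rw [FiberBundle.extend_apply_self, e1] at e2
  have hz : D (FiberBundle.extend E (σ x)) x = 0 := by
    have hev : T (FiberBundle.extend E (σ x)) =ᶠ[𝓝 x] fun _ ↦ (show E from σ x) := by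
      filter_upwards [(trivializationAt E (TangentSpace I : M → Type _) x).open_baseSet.mem_nhds
        (FiberBundle.mem_baseSet_trivializationAt' x)] with z hz
      let e := trivializationAt E (TangentSpace I : M → Type _) x
      let c : E := (e (⟨x, σ x⟩ : TangentBundle I M)).2
      have h3 : e (⟨z, e.symm z c⟩ : TangentBundle I M) = (z, c) := by
        rw [e.mk_symm hz c]
        exact e.apply_symm_apply (e.mem_target.2 hz)
      exact (congrArg Prod.snd h3).trans (trivializationAt_self x (σ x))
    change mvfderiv I (T (FiberBundle.extend E (σ x))) x = 0
    have h1 : mfderiv I 𝓘(ℝ, E) (T (FiberBundle.extend E (σ x))) x = 0 := by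
      rw [hev.mfderiv_eq, mfderiv_const]
      rfl
    exact h1
  rw [hz, sub_zero] at e2
  have e3 := congrArg (fun L : TangentSpace I x →L[ℝ] TangentSpace I x ↦ L w) e2
  exact sub_eq_iff_eq_add'.1 e3

/-- The connection map of the differential of a vector field is its covariant derivative. -/
theorem connectionMap_mfderiv [FiniteDimensional ℝ E]
    [ContMDiffVectorBundle 1 E (TangentSpace I : M → Type _) I]
    (cov : CovariantDerivative I E (TangentSpace I : M → Type _))
    {σ : Π x : M, TangentSpace I x} {x : M}
    (hσ : MDifferentiableAt I I.tangent (fun y ↦ (⟨y, σ y⟩ : TangentBundle I M)) x)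
    (w : TangentSpace I x) :
    connectionMap cov ⟨x, σ x⟩
      (mfderiv I I.tangent (fun y ↦ (⟨y, σ y⟩ : TangentBundle I M)) x w) = cov σ x w := by
  have h1 : dproj I ⟨x, σ x⟩
      (mfderiv I I.tangent (fun y ↦ (⟨y, σ y⟩ : TangentBundle I M)) x w) = w := by
    have hp : MDifferentiableAt I.tangent I (TotalSpace.proj : TangentBundle I M → M) ⟨x, σ x⟩ :=
      mdifferentiableAt_proj (TangentSpace I : M → Type _)
    have hc := mfderiv_comp (I := I) (I' := I.tangent) (I'' := I) x hp hσ
    have hid : (TotalSpace.proj : TangentBundle I M → M) ∘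
      (fun y ↦ (⟨y, σ y⟩ : TangentBundle I M)) = id := rfl
    rw [hid, mfderiv_id] at hc
    exact (congrArg (fun L : TangentSpace I x →L[ℝ] TangentSpace I x ↦ L w) hc).symm
  have h2 : ∀ ξ, connectionMap cov ⟨x, σ x⟩ ξ = fibreComponent I ⟨x, σ x⟩ ξ
    + cov (FiberBundle.extend E (σ x)) x (dproj I ⟨x, σ x⟩ ξ) := fun _ ↦ rfl
  rw [h2, h1, cov_eq_add_mvfderiv cov hσ]
  exact congrArg (· + _) (fibreComponent_mfderiv hσ w)

/-- The connection map sends the velocity of the curve `t ↦ u + t a` in `T_x M` to `a`. -/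
theorem connectionMap_vertical (cov : CovariantDerivative I E (TangentSpace I : M → Type _))
    (x : M) (u a : TangentSpace I x) (t : ℝ) :
    connectionMap cov ⟨x, u + t • a⟩
      (mfderiv 𝓘(ℝ, ℝ) I.tangent (fun s : ℝ ↦ (⟨x, u + s • a⟩ : TangentBundle I M)) t (1 : ℝ))
      = a := by
  have hT : (fun s : ℝ ↦ (trivializationAt E (TangentSpace I) x
      (⟨x, u + s • a⟩ : TangentBundle I M)).2) = fun s : ℝ ↦ (show E from u) + s • (show E from a) :=
    funext fun s ↦ trivializationAt_self x _
  have h0 : HasFDerivAt (fun s : ℝ ↦ (show E from u) + s • (show E from a))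
      ((ContinuousLinearMap.id ℝ ℝ).smulRight (show E from a)) t :=
    ((hasFDerivAt_id t).smul_const (show E from a)).const_add (show E from u)
  have hd : MDifferentiableAt 𝓘(ℝ, ℝ) I.tangent
      (fun s : ℝ ↦ (⟨x, u + s • a⟩ : TangentBundle I M)) t := by
    refine (mdifferentiableAt_totalSpace I _).2 ⟨mdifferentiableAt_const, ?_⟩
    change MDifferentiableAt 𝓘(ℝ, ℝ) 𝓘(ℝ, E) (fun s : ℝ ↦ (trivializationAt E (TangentSpace I) x
      (⟨x, u + s • a⟩ : TangentBundle I M)).2) t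
    rw [hT]
    exact h0.differentiableAt.mdifferentiableAt
  have h1 : dproj I ⟨x, u + t • a⟩
      (mfderiv 𝓘(ℝ, ℝ) I.tangent (fun s : ℝ ↦ (⟨x, u + s • a⟩ : TangentBundle I M)) t (1 : ℝ))
      = 0 := by
    have hp : MDifferentiableAt I.tangent I (TotalSpace.proj : TangentBundle I M → M)
        ⟨x, u + t • a⟩ := mdifferentiableAt_proj (TangentSpace I : M → Type _)
    have hc := mfderiv_comp (I := 𝓘(ℝ, ℝ)) (I' := I.tangent) (I'' := I) t hp hd
    have hid : (TotalSpace.proj : TangentBundle I M → M) ∘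
      (fun s : ℝ ↦ (⟨x, u + s • a⟩ : TangentBundle I M)) = fun _ ↦ x := rfl
    rw [hid, mfderiv_const] at hc
    exact (congrArg (fun L : ℝ →L[ℝ] TangentSpace I x ↦ L 1) hc).symm
  have h2 : ∀ ξ, connectionMap cov ⟨x, u + t • a⟩ ξ = fibreComponent I ⟨x, u + t • a⟩ ξ
    + cov (FiberBundle.extend E (u + t • a)) x (dproj I ⟨x, u + t • a⟩ ξ) := fun _ ↦ rfl
  rw [h2, h1, map_zero, add_zero]
  refine (fibreComponent_mfderiv hd (1 : ℝ)).trans ?_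
  change mvfderiv 𝓘(ℝ, ℝ) (fun s : ℝ ↦ (trivializationAt E (TangentSpace I) x
      (⟨x, u + s • a⟩ : TangentBundle I M)).2) t (1 : ℝ) = a
  rw [hT]
  have h3 := congrArg (fun L : ℝ →L[ℝ] E ↦ L 1) h0.hasMFDerivAt.mfderiv
  exact h3.trans (one_smul ℝ _)

theorem metric_apply (g : Π x : M, TangentSpace I x →L[ℝ] TangentSpace I x →L[ℝ] ℝ)
    (cov : CovariantDerivative I E (TangentSpace I : M → Type _)) (m₁ m₂ m₃ : ℝ)
    (P : TangentBundle I M) (ξ η : TangentSpace I.tangent P) :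
    metric g cov m₁ m₂ m₃ P ξ η =
      m₁ * g P.1 (dproj I P ξ) (dproj I P η)
        + m₂ * (g P.1 (dproj I P ξ) (connectionMap cov P η)
          + g P.1 (connectionMap cov P ξ) (dproj I P η))
        + m₃ * g P.1 (connectionMap cov P ξ) (connectionMap cov P η) :=
  rfl

theorem metric_hlift_hlift (g : Π x : M, TangentSpace I x →L[ℝ] TangentSpace I x →L[ℝ] ℝ)
    (cov : CovariantDerivative I E (TangentSpace I : M → Type _)) (m₁ m₂ m₃ : ℝ)
    (X Y : Π x : M, TangentSpace I x) (P : TangentBundle I M) :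
    metric g cov m₁ m₂ m₃ P (hlift cov X P) (hlift cov Y P) = m₁ * g P.1 (X P.1) (Y P.1) := by
  simp [metric_apply, hlift, dproj_lift, connectionMap_lift]

theorem metric_hlift_vlift (g : Π x : M, TangentSpace I x →L[ℝ] TangentSpace I x →L[ℝ] ℝ)
    (cov : CovariantDerivative I E (TangentSpace I : M → Type _)) (m₁ m₂ m₃ : ℝ)
    (X Y : Π x : M, TangentSpace I x) (P : TangentBundle I M) :
    metric g cov m₁ m₂ m₃ P (hlift cov X P) (vlift cov Y P) = m₂ * g P.1 (X P.1) (Y P.1) := by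
  simp [metric_apply, hlift, vlift, dproj_lift, connectionMap_lift]

theorem metric_vlift_vlift (g : Π x : M, TangentSpace I x →L[ℝ] TangentSpace I x →L[ℝ] ℝ)
    (cov : CovariantDerivative I E (TangentSpace I : M → Type _)) (m₁ m₂ m₃ : ℝ)
    (X Y : Π x : M, TangentSpace I x) (P : TangentBundle I M) :
    metric g cov m₁ m₂ m₃ P (vlift cov X P) (vlift cov Y P) = m₃ * g P.1 (X P.1) (Y P.1) := by
  simp [metric_apply, vlift, dproj_lift, connectionMap_lift]

end Splitting

end TangentMetric

end

/-! On pairs of vector fields consider `D_{(X₁,Y₁)}(X₂,Y₂) = (∇_{X₁}X₂, ∇_{X₁}Y₂)`, horizontal part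
first. The product of two lifts `fieldLift cov X Y` under the tangent metric is a function on `M`,
so `D` is compatible with that metric. It fails to be torsion free only by curvature: the bracket of
two lifts has horizontal part `[X₁,X₂]` and vertical part `∇_{X₁}Y₂ - ∇_{X₂}Y₁ - R(X₁,X₂)u`. The
Koszul formula on `TM` therefore gives the `D`-term plus curvature terms
(`IsLeviCivita.koszul_fieldLift`). The curvature symmetries move the test vector out of the
curvature, and what remains is a linear system with matrix `((m₁,m₂),(m₂,m₃))` for the two
components (`IsLeviCivita.metric_components_cov_fieldLift`). Solving it gives a single formula,
`IsLeviCivita.components_cov_fieldLift`; the eight claims are its cases with one field of each pair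
equal to zero.

The bracket is found by reading it as a commutator of derivations (`mvfderiv_mlieBracket`) and
testing it on two families of functions on `TM`: chart functions pulled back from `M`, which see the
horizontal part, and `u ↦ g(Z,u)`, which see the vertical part
(`metric_connectionMap_mlieBracket_fieldLift`).

Two foundations are laid along the way. A covariant derivative carries no smoothness by itself, so
the regularity of `∇_X Y`, and with it the differentiability of the lifts, is extracted from the
Koszul formula on `M` (`IsLeviCivita.diffFieldAt_cov`). That curvature depends on values only
follows from the bracket formula and pair symmetry (`IsLeviCivita.curvatureField_congr`). -/

namespace TangentMetric

/-! ### Vector fields as derivations, and the Lie bracket as their commutator. -/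

section Derivations

variable {E : Type*} [NormedAddCommGroup E] [NormedSpace ℝ E]
  {H : Type*} [TopologicalSpace H] {I : ModelWithCorners ℝ E H}
  {M : Type*} [TopologicalSpace M] [ChartedSpace H M]
  {F : Type*} [NormedAddCommGroup F] [NormedSpace ℝ F]

open VectorField

/-- The expression of a vector field in the preferred extended chart at `p`. -/
noncomputable abbrev chartField (V : Π x : M, TangentSpace I x) (p : M) : E → E :=
  mpullbackWithin 𝓘(ℝ, E) I (extChartAt I p).symm V (Set.range I)

/-- The chart stays the one at `p` while `q` moves, so that `q ↦ (V f)(q)` can be differentiated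
again in a single chart. -/
theorem mvfderiv_apply_eq_chart [I.Boundaryless] [IsManifold I 1 M] {f : M → F} {p q : M}
    (V : Π x : M, TangentSpace I x) (hq : q ∈ (extChartAt I p).source)
    (hf : MDifferentiableAt I 𝓘(ℝ, F) f q) :
    mvfderiv I f q (V q) =
      fderiv ℝ (f ∘ (extChartAt I p).symm) (extChartAt I p q)
        (chartField V p (extChartAt I p q)) := by
  have hz : extChartAt I p q ∈ (extChartAt I p).target := (extChartAt I p).map_source hq
  have hA := isInvertible_mfderivWithin_extChartAt_symm hz
  have hs : (extChartAt I p).symm (extChartAt I p q) = q := (extChartAt I p).left_inv hq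
  have hf' : MDifferentiableAt I 𝓘(ℝ, F) f ((extChartAt I p).symm (extChartAt I p q)) := by
    rwa [hs]
  have hd : MDifferentiableWithinAt 𝓘(ℝ, E) I (extChartAt I p).symm (Set.range I)
      (extChartAt I p q) := mdifferentiableWithinAt_extChartAt_symm hz
  have hc := mfderiv_comp_mfderivWithin (I := 𝓘(ℝ, E)) (I' := I) (I'' := 𝓘(ℝ, F)) _ hf' hd
    (by rw [I.range_eq_univ]; exact uniqueMDiffWithinAt_univ _)
  have h1 : mfderivWithin 𝓘(ℝ, E) 𝓘(ℝ, F) (f ∘ (extChartAt I p).symm) (Set.range I)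
      (extChartAt I p q) = fderiv ℝ (f ∘ (extChartAt I p).symm) (extChartAt I p q) := by
    rw [I.range_eq_univ, mfderivWithin_univ, mfderiv_eq_fderiv]
  have h2 := congrArg (fun L : E →L[ℝ] F ↦ L (chartField V p (extChartAt I p q))) (h1.symm.trans hc)
  refine Eq.trans ?_ h2.symm
  obtain ⟨e, he⟩ := hA
  have h3 : chartField V p (extChartAt I p q) = e.symm (V q) := by
    simp only [chartField, mpullbackWithin_apply]
    rw [← he, ContinuousLinearMap.inverse_equiv, hs]
    rfl
  rw [h3]
  change _ = mfderiv I 𝓘(ℝ, F) f ((extChartAt I p).symm (extChartAt I p q))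
    (mfderivWithin 𝓘(ℝ, E) I (extChartAt I p).symm (Set.range I) (extChartAt I p q) (e.symm (V q)))
  rw [← he]
  have h4 : e (e.symm (V q)) = V q := e.apply_symm_apply _
  refine Eq.trans ?_ (congrArg (mfderiv I 𝓘(ℝ, F) f _) h4).symm
  rw [hs]
  rfl

theorem differentiableAt_chartField [I.Boundaryless] [CompleteSpace E] [IsManifold I 2 M]
    {V : Π x : M, TangentSpace I x} {p : M}
    (hV : MDifferentiableAt I I.tangent (fun y ↦ (⟨y, V y⟩ : TangentBundle I M)) p) :
    DifferentiableAt ℝ (chartField V p) (extChartAt I p p) := by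
  have h : DifferentiableWithinAt ℝ (chartField V p)
      ((extChartAt I p).symm ⁻¹' Set.univ ∩ Set.range I) (extChartAt I p p) :=
    MDifferentiableWithinAt.differentiableWithinAt_mpullbackWithin_vectorField
      (mdifferentiableWithinAt_univ.2 hV)
  rwa [Set.preimage_univ, Set.univ_inter, I.range_eq_univ, differentiableWithinAt_univ] at h

theorem contDiffAt_comp_extChartAt_symm [I.Boundaryless] {f : M → F} {p : M} {n : ℕ∞ω}
    (hf : ContMDiffAt I 𝓘(ℝ, F) n f p) :
    ContDiffAt ℝ n (f ∘ (extChartAt I p).symm) (extChartAt I p p) := by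
  have h := (contMDiffAt_iff.1 hf).2
  rw [I.range_eq_univ, contDiffWithinAt_univ] at h
  exact h

/-- Regularity at a point spreads to a neighbourhood for a finite order but not for `∞`; this is why
the argument runs with `C²` fields. -/
theorem eventually_contMDiffAt {E' : Type*} [NormedAddCommGroup E'] [NormedSpace ℝ E']
    {H' : Type*} [TopologicalSpace H'] {I' : ModelWithCorners ℝ E' H'}
    {M' : Type*} [TopologicalSpace M'] [ChartedSpace H' M'] [IsManifold I 2 M] [IsManifold I' 2 M']
    {f : M → M'} {p : M} (hf : ContMDiffAt I I' 2 f p) : ∀ᶠ q in 𝓝 p, ContMDiffAt I I' 2 f q :=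
  (contMDiffAt_iff_contMDiffAt_nhds (by decide)).1 hf

theorem eventually_mvfderiv_apply_eq_chart [I.Boundaryless] [IsManifold I 2 M] {f : M → F} {p : M}
    (V : Π x : M, TangentSpace I x) (hf : ContMDiffAt I 𝓘(ℝ, F) 2 f p) :
    ∀ᶠ q in 𝓝 p, mvfderiv I f q (V q) =
      fderiv ℝ (f ∘ (extChartAt I p).symm) (extChartAt I p q)
        (chartField V p (extChartAt I p q)) := by
  have : IsManifold I 1 M := IsManifold.of_le one_le_two
  filter_upwards [extChartAt_source_mem_nhds (I := I) p, eventually_contMDiffAt hf] with q hq hfq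
  exact mvfderiv_apply_eq_chart V hq (hfq.mdifferentiableAt two_ne_zero)

theorem differentiableAt_fderiv_chartField [I.Boundaryless] [CompleteSpace E] [IsManifold I 2 M]
    {f : M → F} {p : M} {V : Π x : M, TangentSpace I x} (hf : ContMDiffAt I 𝓘(ℝ, F) 2 f p)
    (hV : MDifferentiableAt I I.tangent (fun y ↦ (⟨y, V y⟩ : TangentBundle I M)) p) :
    DifferentiableAt ℝ
      (fun z ↦ fderiv ℝ (f ∘ (extChartAt I p).symm) z (chartField V p z)) (extChartAt I p p) :=
  (((contDiffAt_comp_extChartAt_symm hf).fderiv_right (m := 1)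
    (by norm_num)).differentiableAt one_ne_zero).clm_apply (differentiableAt_chartField hV)

/-- The derivative of a `C²` function along a differentiable vector field is differentiable. -/
theorem mdifferentiableAt_mvfderiv_apply [I.Boundaryless] [CompleteSpace E] [IsManifold I 2 M]
    {f : M → F} {p : M} {V : Π x : M, TangentSpace I x} (hf : ContMDiffAt I 𝓘(ℝ, F) 2 f p)
    (hV : MDifferentiableAt I I.tangent (fun y ↦ (⟨y, V y⟩ : TangentBundle I M)) p) :
    MDifferentiableAt I 𝓘(ℝ, F) (fun q ↦ mvfderiv I f q (V q)) p := by
  have h1 := (differentiableAt_fderiv_chartField hf hV).mdifferentiableAt.comp p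
    (mdifferentiableAt_extChartAt (mem_chart_source H p))
  exact h1.congr_of_eventuallyEq (eventually_mvfderiv_apply_eq_chart V hf)

theorem mvfderiv_mvfderiv_apply_eq_chart [I.Boundaryless] [CompleteSpace E] [IsManifold I 2 M]
    {f : M → F} {p : M} {V W : Π x : M, TangentSpace I x} (hf : ContMDiffAt I 𝓘(ℝ, F) 2 f p)
    (hW : MDifferentiableAt I I.tangent (fun y ↦ (⟨y, W y⟩ : TangentBundle I M)) p) :
    mvfderiv I (fun q ↦ mvfderiv I f q (W q)) p (V p) =
      fderiv ℝ (fun z ↦ fderiv ℝ (f ∘ (extChartAt I p).symm) z (chartField W p z))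
        (extChartAt I p p) (chartField V p (extChartAt I p p)) := by
  have : IsManifold I 1 M := IsManifold.of_le one_le_two
  rw [mvfderiv_apply_eq_chart V (mem_extChartAt_source p)
    (mdifferentiableAt_mvfderiv_apply hf hW)]
  congr 1
  refine Filter.EventuallyEq.fderiv_eq ?_
  have h1 := (continuousAt_extChartAt_symm (I := I) p).eventually
    (p := fun q ↦ mvfderiv I f q (W q) = fderiv ℝ (f ∘ (extChartAt I p).symm) (extChartAt I p q)
        (chartField W p (extChartAt I p q)))
    (by rw [extChartAt_to_inv]; exact eventually_mvfderiv_apply_eq_chart W hf)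
  filter_upwards [h1, extChartAt_target_mem_nhds (I := I) p] with z hz hz'
  have h2 : extChartAt I p ((extChartAt I p).symm z) = z := (extChartAt I p).right_inv hz'
  rw [h2] at hz
  exact hz

/-- The Lie bracket of vector fields is the commutator of the associated derivations. -/
theorem mvfderiv_mlieBracket [I.Boundaryless] [CompleteSpace E] [IsManifold I 2 M]
    {f : M → F} {p : M} {V W : Π x : M, TangentSpace I x} (hf : ContMDiffAt I 𝓘(ℝ, F) 2 f p)
    (hV : MDifferentiableAt I I.tangent (fun y ↦ (⟨y, V y⟩ : TangentBundle I M)) p)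
    (hW : MDifferentiableAt I I.tangent (fun y ↦ (⟨y, W y⟩ : TangentBundle I M)) p) :
    mvfderiv I f p (mlieBracket I V W p) =
      mvfderiv I (fun q ↦ mvfderiv I f q (W q)) p (V p)
        - mvfderiv I (fun q ↦ mvfderiv I f q (V q)) p (W p) := by
  have : IsManifold I 1 M := IsManifold.of_le one_le_two
  have hc := contDiffAt_comp_extChartAt_symm hf
  have hd := (hc.fderiv_right (m := 1) (by norm_num)).differentiableAt one_ne_zero
  rw [mvfderiv_mvfderiv_apply_eq_chart hf hW, mvfderiv_mvfderiv_apply_eq_chart hf hV,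
    fderiv_clm_apply hd (differentiableAt_chartField hW),
    fderiv_clm_apply hd (differentiableAt_chartField hV)]
  -- In the commutator the second derivatives of `f` cancel by symmetry; the derivatives of the
  -- fields form the bracket in the chart.
  have hsymm := hc.isSymmSndFDerivAt (by simp)
  have hb : mvfderiv I f p (mlieBracket I V W p) = fderiv ℝ (f ∘ (extChartAt I p).symm)
      (extChartAt I p p) (lieBracket ℝ (chartField V p) (chartField W p) (extChartAt I p p)) := by
    rw [mvfderiv_apply_eq_chart (mlieBracket I V W) (mem_extChartAt_source p)
      (hf.mdifferentiableAt two_ne_zero)]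
    congr 1
    have hz := mem_extChartAt_target (I := I) p
    have hA := isInvertible_mfderivWithin_extChartAt_symm (I := I) hz
    have hB := isInvertible_mfderiv_extChartAt (I := I) (mem_extChartAt_source (I := I) p)
    have hid := mfderiv_extChartAt_comp_mfderivWithin_extChartAt_symm' (I := I)
      (mem_extChartAt_source (I := I) p)
    simp only [chartField, mpullbackWithin_apply]
    rw [extChartAt_to_inv, ← mlieBracketWithin_univ, mlieBracketWithin_apply, Set.preimage_univ,
      Set.univ_inter]
    -- The bracket on `M` is the chart bracket carried over by the differential of the chart.
    -- Reading it in the chart undoes this, the two differentials being mutually inverse.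
    have key : ∀ A B : E →L[ℝ] E, A.IsInvertible → B.IsInvertible →
        B.comp A = ContinuousLinearMap.id ℝ E → ∀ v : E, A.inverse (B.inverse v) = v := by
      rintro _ _ ⟨e, rfl⟩ ⟨e', rfl⟩ h v
      rw [ContinuousLinearMap.inverse_equiv, ContinuousLinearMap.inverse_equiv]
      have h1 : e' (e v) = v := congrArg (fun L : E →L[ℝ] E ↦ L v) h
      change e.symm (e'.symm v) = v
      rw [← h1, e'.symm_apply_apply, e.symm_apply_apply, h1]
    refine (key _ _ hA hB hid _).trans ?_
    exact (congrArg (fun s ↦ lieBracketWithin ℝ (chartField V p) (chartField W p) s _)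
      I.range_eq_univ).trans (congrFun lieBracketWithin_univ _)
  rw [hb, lieBracket]
  simp only [add_apply, ContinuousLinearMap.comp_apply,
    ContinuousLinearMap.flip_apply, map_sub]
  rw [hsymm.eq]
  abel

end Derivations

/-! ### Regularity of vector fields and of their scalar products. -/

section VectorFields

variable {E : Type*} [NormedAddCommGroup E] [NormedSpace ℝ E]
  {H : Type*} [TopologicalSpace H] {I : ModelWithCorners ℝ E H}
  {M : Type*} [TopologicalSpace M] [ChartedSpace H M]

open VectorField

/-- The vector field `X` is differentiable at `x`. -/
abbrev DiffFieldAt [IsManifold I 1 M] (X : Π x : M, TangentSpace I x) (x : M) : Prop :=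
  MDifferentiableAt I I.tangent (fun y ↦ (⟨y, X y⟩ : TangentBundle I M)) x

/-- The vector field `X` is twice continuously differentiable near `x`. -/
abbrev C2FieldAt [IsManifold I 1 M] (X : Π x : M, TangentSpace I x) (x : M) : Prop :=
  ContMDiffAt I I.tangent 2 (fun y ↦ (⟨y, X y⟩ : TangentBundle I M)) x

variable [IsManifold I ∞ M]

theorem C2FieldAt.diffFieldAt {X : Π x : M, TangentSpace I x} {x : M} (hX : C2FieldAt X x) :
    DiffFieldAt X x := hX.mdifferentiableAt two_ne_zero

theorem C2FieldAt.eventually {X : Π x : M, TangentSpace I x} {x : M} (hX : C2FieldAt X x) :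
    ∀ᶠ y in 𝓝 x, C2FieldAt X y := eventually_contMDiffAt hX

theorem C2FieldAt.mlieBracket [CompleteSpace E] {X Y : Π x : M, TangentSpace I x} {x : M}
    (hX : C2FieldAt X x) (hY : C2FieldAt Y x) : DiffFieldAt (mlieBracket I X Y) x := by
  have : IsManifold I (minSmoothness ℝ 2) M := by
    rw [minSmoothness_of_isRCLikeNormedField]; infer_instance
  have : IsManifold I ((2 : ℕ∞) + 1) M := IsManifold.of_le (n := ∞) (by norm_num; exact ENat.LEInfty.out)
  exact (ContMDiffAt.mlieBracket_vectorField (m := 1) (n := 2) hX hY (by simp; norm_num)).mdifferentiableAt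
    one_ne_zero

theorem c2FieldAt_extend [FiniteDimensional ℝ E] {x : M} (v : TangentSpace I x) :
    C2FieldAt (FiberBundle.extend E v) x :=
  FiberBundle.contMDiffAt_extend I E v

/-- The trivialization of the tangent bundle at `p` is the differential of the chart, so the
components of `V` are the derivatives of the chart along `V`. -/
theorem diffFieldAt_of_mvfderiv_extChartAt {V : Π x : M, TangentSpace I x} {p : M}
    (h : MDifferentiableAt I 𝓘(ℝ, E) (fun q ↦ mvfderiv I (extChartAt I p) q (V q)) p) :
    DiffFieldAt V p := by
  rw [DiffFieldAt, mdifferentiableAt_totalSpace]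
  refine ⟨mdifferentiableAt_id, h.congr_of_eventuallyEq ?_⟩
  filter_upwards [extChartAt_source_mem_nhds (I := I) p] with q hq
  rw [extChartAt_source] at hq
  have h1 := TangentBundle.continuousLinearMapAt_trivializationAt (I := I) hq
  have h2 := congrArg (fun L : E →L[ℝ] E ↦ L (V q)) h1
  refine Eq.trans ?_ h2
  symm
  exact Trivialization.continuousLinearMapAt_apply_of_mem _ _ hq _

variable (g : ContMDiffRiemannianMetric I ∞ E (fun x : M ↦ TangentSpace I x))

/-- The scalar product of two sections of class `C^n` of the tangent bundle along a map. -/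
theorem contMDiffAt_metric {E' : Type*} [NormedAddCommGroup E'] [NormedSpace ℝ E']
    {H' : Type*} [TopologicalSpace H'] {J : ModelWithCorners ℝ E' H'}
    {N : Type*} [TopologicalSpace N] [ChartedSpace H' N] {b : N → M}
    {v w : Π n : N, TangentSpace I (b n)} {n : N}
    (hv : ContMDiffAt J I.tangent 2 (fun m ↦ (⟨b m, v m⟩ : TangentBundle I M)) n)
    (hw : ContMDiffAt J I.tangent 2 (fun m ↦ (⟨b m, w m⟩ : TangentBundle I M)) n) :
    ContMDiffAt J 𝓘(ℝ, ℝ) 2 (fun m ↦ g.inner (b m) (v m) (w m)) n := by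
  have hb : ContMDiffAt J I 2 b n := (contMDiffAt_totalSpace.1 hv).1
  have hg : ContMDiff I (I.prod 𝓘(ℝ, E →L[ℝ] E →L[ℝ] ℝ)) 2
    (fun b ↦ TotalSpace.mk' (E →L[ℝ] E →L[ℝ] ℝ) b (g.inner b)) :=
    g.contMDiff.of_le ENat.LEInfty.out
  have : ContMDiffAt J (I.prod 𝓘(ℝ)) 2
      (fun m ↦ TotalSpace.mk' ℝ (E := Bundle.Trivial M ℝ) (b m) (g.inner (b m) (v m) (w m))) n := by
    apply ContMDiffAt.clm_bundle_apply₂ (F₁ := E) (F₂ := E)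
    · exact ContMDiffAt.comp n hg.contMDiffAt hb
    · exact hv
    · exact hw
  exact (contMDiffAt_totalSpace.1 this).2

theorem mdifferentiableAt_metric {E' : Type*} [NormedAddCommGroup E'] [NormedSpace ℝ E']
    {H' : Type*} [TopologicalSpace H'] {J : ModelWithCorners ℝ E' H'}
    {N : Type*} [TopologicalSpace N] [ChartedSpace H' N] {b : N → M}
    {v w : Π n : N, TangentSpace I (b n)} {n : N}
    (hv : MDifferentiableAt J I.tangent (fun m ↦ (⟨b m, v m⟩ : TangentBundle I M)) n)
    (hw : MDifferentiableAt J I.tangent (fun m ↦ (⟨b m, w m⟩ : TangentBundle I M)) n) :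
    MDifferentiableAt J 𝓘(ℝ, ℝ) (fun m ↦ g.inner (b m) (v m) (w m)) n := by
  have hb : MDifferentiableAt J I b n := ((mdifferentiableAt_totalSpace _ _).1 hv).1
  have hg : ContMDiff I (I.prod 𝓘(ℝ, E →L[ℝ] E →L[ℝ] ℝ)) 2
    (fun b ↦ TotalSpace.mk' (E →L[ℝ] E →L[ℝ] ℝ) b (g.inner b)) :=
    g.contMDiff.of_le ENat.LEInfty.out
  have : MDifferentiableAt J (I.prod 𝓘(ℝ))
      (fun m ↦ TotalSpace.mk' ℝ (E := Bundle.Trivial M ℝ) (b m) (g.inner (b m) (v m) (w m))) n := by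
    apply MDifferentiableAt.clm_bundle_apply₂ (F₁ := E) (F₂ := E)
    · exact MDifferentiableAt.comp n (hg.mdifferentiableAt two_ne_zero) hb
    · exact hv
    · exact hw
  exact ((mdifferentiableAt_totalSpace _ _).1 this).2

theorem metric_ext {x : M} {a b : TangentSpace I x}
    (h : ∀ c, g.inner x a c = g.inner x b c) : a = b := by
  by_contra hab
  have h1 := g.pos x (a - b) (sub_ne_zero.2 hab)
  have h2 : g.inner x (a - b) (a - b) = g.inner x a (a - b) - g.inner x b (a - b) := by
    rw [map_sub (g.inner x), sub_apply]
  rw [h2, h, sub_self] at h1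
  exact lt_irrefl _ h1

end VectorFields

/-! ### The Koszul formula. -/

section LeviCivita

variable {E : Type*} [NormedAddCommGroup E] [NormedSpace ℝ E] [FiniteDimensional ℝ E]
  {H : Type*} [TopologicalSpace H] {I : ModelWithCorners ℝ E H}
  {M : Type*} [TopologicalSpace M] [ChartedSpace H M] [IsManifold I ∞ M]
  {g : Π x : M, TangentSpace I x →L[ℝ] TangentSpace I x →L[ℝ] ℝ}
  {cov : CovariantDerivative I E (TangentSpace I : M → Type _)}

open VectorField

theorem IsLeviCivita.cov_sub_cov (hcov : IsLeviCivita g cov) {X Y : Π x : M, TangentSpace I x}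
    {x : M} (hX : DiffFieldAt X x) (hY : DiffFieldAt Y x) :
    cov Y x (X x) - cov X x (Y x) = mlieBracket I X Y x := by
  have := FiniteDimensional.complete ℝ E
  exact cov.torsion_eq_zero_iff.1 hcov.torsion_eq_zero hX hY

/-- Only symmetry of the forms enters, so the formula serves both on `M`, for the regularity of `∇`,
and on `TM`, for the computation itself. -/
theorem IsLeviCivita.koszul (hcov : IsLeviCivita g cov) (hg : ∀ x v w, g x v w = g x w v)
    {X Y Z : Π x : M, TangentSpace I x} {x : M}
    (hX : DiffFieldAt X x) (hY : DiffFieldAt Y x) (hZ : DiffFieldAt Z x) :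
    2 * g x (cov Y x (X x)) (Z x) =
      mvfderiv I (fun y ↦ g y (Y y) (Z y)) x (X x)
        + mvfderiv I (fun y ↦ g y (X y) (Z y)) x (Y x)
        - mvfderiv I (fun y ↦ g y (X y) (Y y)) x (Z x)
        + g x (mlieBracket I X Y x) (Z x) - g x (X x) (mlieBracket I Y Z x)
        + g x (Y x) (mlieBracket I Z X x) := by
  rw [hcov.compatible hY hZ, hcov.compatible hX hZ, hcov.compatible hX hY,
    ← hcov.cov_sub_cov hX hY, ← hcov.cov_sub_cov hY hZ, ← hcov.cov_sub_cov hZ hX]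
  simp only [map_sub, sub_apply]
  rw [hg x (X x) (cov Y x (Z x)), hg x (X x) (cov Z x (Y x)), hg x (Y x) (cov X x (Z x)),
    hg x (Y x) (cov Z x (X x))]
  ring

end LeviCivita

/-! ### Regularity of a field from its scalar products, and of the Levi-Civita connection. -/

section Musical

variable {E : Type*} [NormedAddCommGroup E] [NormedSpace ℝ E]
  {H : Type*} [TopologicalSpace H] {I : ModelWithCorners ℝ E H}
  {M : Type*} [TopologicalSpace M] [ChartedSpace H M]

open VectorField

theorem mdifferentiableAt_det {ι : Type} [Fintype ι] [DecidableEq ι]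
    {A : M → Matrix ι ι ℝ} {x : M} (hA : ∀ i j, MDifferentiableAt I 𝓘(ℝ, ℝ) (fun y ↦ A y i j) x) :
    MDifferentiableAt I 𝓘(ℝ, ℝ) (fun y ↦ (A y).det) x := by
  simp only [Matrix.det_apply', mul_comm (Equiv.Perm.sign _ : ℝ)]
  have h1 : ∀ σ : Equiv.Perm ι, MDifferentiableAt I 𝓘(ℝ, ℝ)
      ((∏ i, fun y ↦ A y (σ i) i) * fun _ ↦ ((Equiv.Perm.sign σ : ℤ) : ℝ)) x := fun σ ↦
    (MDifferentiableAt.prod fun i _ ↦ hA (σ i) i).mul mdifferentiableAt_const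
  have h := MDifferentiableAt.sum (t := Finset.univ) fun σ _ ↦ h1 σ
  refine h.congr_of_eventuallyEq (Filter.Eventually.of_forall fun y ↦ ?_)
  simp [Finset.sum_apply, Finset.prod_apply]

/-- The solution of a linear system with differentiable coefficients is differentiable. -/
theorem mdifferentiableAt_of_mulVec {ι : Type} [Fintype ι] [DecidableEq ι]
    {A : M → Matrix ι ι ℝ} {c : M → ι → ℝ} {x : M}
    (hA : ∀ i j, MDifferentiableAt I 𝓘(ℝ, ℝ) (fun y ↦ A y i j) x)
    (hdet : ∀ᶠ y in 𝓝 x, (A y).det ≠ 0)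
    (hc : ∀ i, MDifferentiableAt I 𝓘(ℝ, ℝ) (fun y ↦ (A y).mulVec (c y) i) x) (i : ι) :
    MDifferentiableAt I 𝓘(ℝ, ℝ) (fun y ↦ c y i) x := by
  -- Cramer's rule: the determinant with column `i` replaced by `A c` is `det A * c i`.
  have h1 : MDifferentiableAt I 𝓘(ℝ, ℝ)
      (fun y ↦ ((A y).updateCol i ((A y).mulVec (c y))).det) x := by
    refine mdifferentiableAt_det fun k l ↦ ?_
    simp only [Matrix.updateCol_apply]
    split_ifs
    · exact hc k
    · exact hA k l
  have h2 := mdifferentiableAt_det hA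
  have h3 : MDifferentiableAt I 𝓘(ℝ, ℝ) (fun y ↦ ((A y).det)⁻¹) x :=
    (differentiableAt_inv hdet.self_of_nhds).mdifferentiableAt.comp x h2
  refine (h1.mul h3).congr_of_eventuallyEq ?_
  filter_upwards [hdet] with y hy
  have h4 : ((A y).updateCol i ((A y).mulVec (c y))).det = (A y).det * c y i := by
    rw [← Matrix.cramer_apply, Matrix.cramer_eq_adjugate_mulVec, Matrix.mulVec_mulVec,
      Matrix.adjugate_mul, Matrix.smul_mulVec, Matrix.one_mulVec]
    rfl
  simp only [Pi.mul_apply]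
  rw [h4]
  field_simp

variable [FiniteDimensional ℝ E] [IsManifold I ∞ M]
  (g : ContMDiffRiemannianMetric I ∞ E (fun x : M ↦ TangentSpace I x))

/-- A vector field is differentiable at `x` as soon as its scalar products with vector fields
of class `C²` are. -/
theorem diffFieldAt_of_metric {S : Π x : M, TangentSpace I x} {x : M}
    (h : ∀ Z : Π x : M, TangentSpace I x, C2FieldAt Z x →
      MDifferentiableAt I 𝓘(ℝ, ℝ) (fun y ↦ g.inner y (S y) (Z y)) x) : DiffFieldAt S x := by
  classical
  let e := trivializationAt E (TangentSpace I : M → Type _) x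
  let b := Module.finBasis ℝ E
  let s := e.localFrame b
  have hs : IsLocalFrameOn I E 1 s e.baseSet := e.isLocalFrameOn_localFrame_baseSet I 1 b
  have hx : x ∈ e.baseSet := FiberBundle.mem_baseSet_trivializationAt' x
  have hn : e.baseSet ∈ 𝓝 x := e.open_baseSet.mem_nhds hx
  have hsx : ∀ i, C2FieldAt (s i) x := 
    (e.isLocalFrameOn_localFrame_baseSet I 2 b).contMDiffAt e.open_baseSet hx
  -- The Gram matrix of a local frame sends the coefficients of `S` to the scalar products `g(S, s
  -- i)`.
  let A : M → Matrix _ _ ℝ := fun y ↦ Matrix.of fun i j ↦ g.inner y (s i y) (s j y)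
  refine hs.mdifferentiableAt_of_coeff (fun i ↦ ?_) hn
  refine mdifferentiableAt_of_mulVec (A := A) (c := fun y i ↦ hs.coeff i y (S y))
    (fun i j ↦ mdifferentiableAt_metric g (hsx i).diffFieldAt (hsx j).diffFieldAt) ?_ ?_ i
  · filter_upwards [hn] with y hy
    intro hdet
    -- A kernel vector of the Gram matrix would give a combination of the frame of length zero,
    -- against linear independence.
    obtain ⟨v, hv, hv'⟩ := Matrix.exists_mulVec_eq_zero_iff.2 hdet
    have h0 : ∑ i, v i • s i y = 0 := by
      by_contra hne
      have hpos := g.pos y _ hne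
      have h1 : g.inner y (∑ i, v i • s i y) (∑ i, v i • s i y)
          = ∑ i, v i * (A y).mulVec v i := by
        simp only [map_sum, sum_apply, map_smul, smul_apply,
          Matrix.mulVec, dotProduct, smul_eq_mul, Finset.mul_sum, A, Matrix.of_apply]
        rw [Finset.sum_comm]
        refine Finset.sum_congr rfl fun i _ ↦ Finset.sum_congr rfl fun j _ ↦ by ring
      rw [h1, hv'] at hpos
      simp at hpos
    exact hv (funext fun i ↦ linearIndependent_iff'.1 (hs.linearIndependent hy) Finset.univ v h0 i
      (Finset.mem_univ i))
  · intro i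
    refine (h (s i) (hsx i)).congr_of_eventuallyEq ?_
    filter_upwards [hn] with y hy
    conv_rhs => rw [hs.coeff_sum_eq S hy]
    simp only [map_sum, sum_apply, map_smul, smul_apply,
          Matrix.mulVec, dotProduct, smul_eq_mul, A, Matrix.of_apply]
    refine Finset.sum_congr rfl fun j _ ↦ ?_
    rw [g.symm, mul_comm]

variable {g} [I.Boundaryless] {cov : CovariantDerivative I E (TangentSpace I : M → Type _)}

/-- The Levi-Civita connection maps vector fields of class `C²` to differentiable ones. -/
theorem IsLeviCivita.diffFieldAt_cov (hcov : IsLeviCivita g.inner cov)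
    {X Y : Π x : M, TangentSpace I x} {x : M} (hX : C2FieldAt X x) (hY : C2FieldAt Y x) :
    DiffFieldAt (fun y ↦ cov Y y (X y)) x := by
  have := FiniteDimensional.complete ℝ E
  refine diffFieldAt_of_metric g fun Z hZ ↦ ?_
  have hd : ∀ {U V W : Π x : M, TangentSpace I x}, C2FieldAt U x → C2FieldAt V x → C2FieldAt W x →
      MDifferentiableAt I 𝓘(ℝ, ℝ)
        (fun y ↦ mvfderiv I (fun y ↦ g.inner y (V y) (W y)) y (U y)) x := fun hU hV hW ↦
    mdifferentiableAt_mvfderiv_apply (contMDiffAt_metric g hV hW) hU.diffFieldAt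
  -- The right-hand side of the Koszul formula, term by term: it involves `cov` nowhere, only first
  -- derivatives of `C²` data.
  have h1 := (((((hd hX hY hZ).add (hd hY hX hZ)).sub (hd hZ hX hY)).add
    (mdifferentiableAt_metric g (hX.mlieBracket hY) hZ.diffFieldAt)).sub
    (mdifferentiableAt_metric g hX.diffFieldAt (hY.mlieBracket hZ))).add
    (mdifferentiableAt_metric g hY.diffFieldAt (hZ.mlieBracket hX))
  have h2 : MDifferentiableAt I 𝓘(ℝ, ℝ) (fun _ : M ↦ (2 : ℝ)⁻¹) x := mdifferentiableAt_const
  refine (h2.mul h1).congr_of_eventuallyEq ?_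
  filter_upwards [hX.eventually, hY.eventually, hZ.eventually] with y hX hY hZ
  have hk := hcov.koszul g.symm hX.diffFieldAt hY.diffFieldAt hZ.diffFieldAt
  simp only [Pi.mul_apply, Pi.add_apply, Pi.sub_apply]
  rw [← hk]
  ring

end Musical

/-! ### Differentiating functions on the tangent bundle. -/

section TangentCalculus

variable {E : Type*} [NormedAddCommGroup E] [NormedSpace ℝ E]
  {H : Type*} [TopologicalSpace H] {I : ModelWithCorners ℝ E H}
  {M : Type*} [TopologicalSpace M] [ChartedSpace H M] [IsManifold I ∞ M]
  {F : Type*} [NormedAddCommGroup F] [NormedSpace ℝ F]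
  (cov : CovariantDerivative I E (TangentSpace I : M → Type _))

open VectorField

theorem mvfderiv_comp_proj {f : M → F} {Q : TangentBundle I M}
    (hf : MDifferentiableAt I 𝓘(ℝ, F) f Q.1) (ξ : TangentSpace I.tangent Q) :
    mvfderiv I.tangent (fun P : TangentBundle I M ↦ f P.1) Q ξ = mvfderiv I f Q.1 (dproj I Q ξ) :=
  congrArg (fun L : E × E →L[ℝ] F ↦ L ξ) (mfderiv_comp (I := I.tangent) (I' := I) (I'' := 𝓘(ℝ, F)) Q
    hf (mdifferentiableAt_proj (TangentSpace I : M → Type _)))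

theorem lift_add_lift (P : TangentBundle I M) (a b a' b' : TangentSpace I P.1) :
    lift cov P a b + lift cov P a' b' = lift cov P (a + a') (b + b') := by
  refine Prod.ext rfl ?_
  change (b - cov (FiberBundle.extend E P.2) P.1 a) + (b' - cov (FiberBundle.extend E P.2) P.1 a')
    = (b + b') - cov (FiberBundle.extend E P.2) P.1 (a + a')
  rw [map_add]
  abel

theorem lift_zero_left (P : TangentBundle I M) (b : TangentSpace I P.1) :
    lift cov P 0 b = ((0, b) : E × E) := by
  refine Prod.ext rfl ?_
  change b - cov (FiberBundle.extend E P.2) P.1 0 = b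
  rw [map_zero, sub_zero]

/-- The derivative in a vertical direction is the derivative along the fibre. -/
theorem mvfderiv_lift_zero {Φ : TangentBundle I M → F} {x : M} {u a : TangentSpace I x}
    (hΦ : MDifferentiableAt I.tangent 𝓘(ℝ, F) Φ ⟨x, u⟩) {d : F}
    (hd : HasDerivAt (fun s : ℝ ↦ Φ ⟨x, u + s • a⟩) d 0) :
    mvfderiv I.tangent Φ ⟨x, u⟩ (lift cov ⟨x, u⟩ 0 a) = d := by
  let c : ℝ → TangentBundle I M := fun s ↦ ⟨x, u + s • a⟩
  have hc0 : c 0 = ⟨x, u⟩ := by simp [c]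
  have hT : (fun s : ℝ ↦ (trivializationAt E (TangentSpace I) x
      (⟨x, u + s • a⟩ : TangentBundle I M)).2) = fun s : ℝ ↦ (show E from u) + s • (show E from a) :=
    funext fun s ↦ trivializationAt_self x _
  have hc : MDifferentiableAt 𝓘(ℝ, ℝ) I.tangent c 0 := by
    refine (mdifferentiableAt_totalSpace I _).2 ⟨mdifferentiableAt_const, ?_⟩
    change MDifferentiableAt 𝓘(ℝ, ℝ) 𝓘(ℝ, E) (fun s : ℝ ↦ (trivializationAt E (TangentSpace I) x
      (⟨x, u + s • a⟩ : TangentBundle I M)).2) 0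
    rw [hT]
    exact ((differentiableAt_id.smul_const (show E from a)).const_add
      (show E from u)).mdifferentiableAt
  have h1 : dproj I (c 0) (mfderiv 𝓘(ℝ, ℝ) I.tangent c 0 (1 : ℝ)) = 0 := by
    have hp : MDifferentiableAt I.tangent I (TotalSpace.proj : TangentBundle I M → M) (c 0) :=
      mdifferentiableAt_proj (TangentSpace I : M → Type _)
    have hcc := mfderiv_comp (I := 𝓘(ℝ, ℝ)) (I' := I.tangent) (I'' := I) 0 hp hc
    have hid : (TotalSpace.proj : TangentBundle I M → M) ∘ c = fun _ ↦ x := rfl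
    rw [hid, mfderiv_const] at hcc
    exact (congrArg (fun L : ℝ →L[ℝ] TangentSpace I x ↦ L 1) hcc).symm
  have h2 := eq_lift cov (c 0) (mfderiv 𝓘(ℝ, ℝ) I.tangent c 0 (1 : ℝ))
  rw [h1] at h2
  have h3 : connectionMap cov (c 0) (mfderiv 𝓘(ℝ, ℝ) I.tangent c 0 (1 : ℝ)) = a :=
    connectionMap_vertical cov x u a 0
  rw [h3, lift_zero_left] at h2
  rw [lift_zero_left]
  have h4 := mfderiv_comp_of_eq (I := 𝓘(ℝ, ℝ)) (I' := I.tangent) (I'' := 𝓘(ℝ, F)) hΦ hc hc0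
  have h5 := congrArg (fun L : ℝ →L[ℝ] F ↦ L 1) h4
  have h6 : mfderiv 𝓘(ℝ, ℝ) 𝓘(ℝ, F) (Φ ∘ c) 0 (1 : ℝ) = d :=
    congrArg (fun L : ℝ →L[ℝ] F ↦ L 1) hd.hasFDerivAt.hasMFDerivAt.mfderiv |>.trans (by simp)
  refine Eq.trans ?_ (h5.symm.trans h6)
  -- The point `c 0` has fibre part `u + 0 • a`, equal to `u` only propositionally; viewed on `E ×
  -- E` the differentials at the two points can be compared.
  have h7 : ∀ Q Q' : TangentBundle I M, Q = Q' → ∀ ξ : E × E,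
      (show E × E →L[ℝ] F from mvfderiv I.tangent Φ Q) ξ =
        (show E × E →L[ℝ] F from mvfderiv I.tangent Φ Q') ξ := by
    rintro _ _ rfl _; rfl
  exact (h7 _ _ hc0.symm _).trans
    (congrArg (fun v : E × E ↦ mvfderiv I.tangent Φ (c 0) v) h2).symm

theorem cov_sum {ι : Type*} (t : Finset ι) (c : ι → ℝ) {s : ι → Π x : M, TangentSpace I x} {x : M}
    (hs : ∀ i, DiffFieldAt (s i) x) :
    cov (fun y ↦ ∑ i ∈ t, c i • s i y) x = ∑ i ∈ t, c i • cov (s i) x := by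
  classical
  have hc : IsCovariantDerivativeOn E cov Set.univ := cov.isCovariantDerivativeOn
  induction t using Finset.induction_on with
  | empty => simp only [Finset.sum_empty]; exact hc.zero
  | insert i t hi ih =>
    have h1 : (fun y ↦ ∑ j ∈ insert i t, c j • s j y) = c i • s i + fun y ↦ ∑ j ∈ t, c j • s j y :=
      funext fun y ↦ Finset.sum_insert hi
    have h2 : DiffFieldAt (c i • s i) x := (hs i).smul_const_section
    have h3 : DiffFieldAt (fun y ↦ ∑ j ∈ t, c j • s j y) x :=
      MDifferentiableAt.sum_section fun j _ ↦ (hs j).smul_const_section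
    rw [h1, Finset.sum_insert hi, ← ih]
    refine (hc.add h2 h3).trans ?_
    congr 1
    exact hc.smul_const (c i) (hs i)

variable [FiniteDimensional ℝ E]

theorem mfderiv_field_eq_lift {σ : Π x : M, TangentSpace I x} {x : M} (hσ : DiffFieldAt σ x)
    (w : TangentSpace I x) :
    mfderiv I I.tangent (fun y ↦ (⟨y, σ y⟩ : TangentBundle I M)) x w =
      lift cov ⟨x, σ x⟩ w (cov σ x w) := by
  have h1 : dproj I ⟨x, σ x⟩
      (mfderiv I I.tangent (fun y ↦ (⟨y, σ y⟩ : TangentBundle I M)) x w) = w := by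
    have hp : MDifferentiableAt I.tangent I (TotalSpace.proj : TangentBundle I M → M) ⟨x, σ x⟩ :=
      mdifferentiableAt_proj (TangentSpace I : M → Type _)
    have hc := mfderiv_comp (I := I) (I' := I.tangent) (I'' := I) x hp hσ
    have hid : (TotalSpace.proj : TangentBundle I M → M) ∘
      (fun y ↦ (⟨y, σ y⟩ : TangentBundle I M)) = id := rfl
    rw [hid, mfderiv_id] at hc
    exact (congrArg (fun L : TangentSpace I x →L[ℝ] TangentSpace I x ↦ L w) hc).symm
  have h := eq_lift cov ⟨x, σ x⟩
    (mfderiv I I.tangent (fun y ↦ (⟨y, σ y⟩ : TangentBundle I M)) x w)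
  rwa [h1, connectionMap_mfderiv cov hσ] at h

/-- A derivative on the tangent bundle splits into derivatives along a vector field and along
a fibre. -/
theorem mvfderiv_lift {Φ : TangentBundle I M → F} {σ : Π x : M, TangentSpace I x} {x : M}
    (hσ : DiffFieldAt σ x) (hΦ : MDifferentiableAt I.tangent 𝓘(ℝ, F) Φ ⟨x, σ x⟩)
    {a b : TangentSpace I x} {d : F}
    (hd : HasDerivAt (fun s : ℝ ↦ Φ ⟨x, σ x + s • (b - cov σ x a)⟩) d 0) :
    mvfderiv I.tangent Φ ⟨x, σ x⟩ (lift cov ⟨x, σ x⟩ a b) =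
      mvfderiv I (fun y ↦ Φ ⟨y, σ y⟩) x a + d := by
  -- The first summand is `dσ(a)`; the second is the vertical remainder.
  have h1 : lift cov ⟨x, σ x⟩ a b = lift cov ⟨x, σ x⟩ a (cov σ x a)
      + lift cov ⟨x, σ x⟩ 0 (b - cov σ x a) := by
    rw [lift_add_lift, add_zero, add_sub_cancel]
  rw [h1, map_add, mvfderiv_lift_zero cov hΦ hd, ← mfderiv_field_eq_lift cov hσ]
  congr 1
  exact (congrArg (fun L : E →L[ℝ] F ↦ L a) (mfderiv_comp (I := I) (I' := I.tangent)
    (I'' := 𝓘(ℝ, F)) x hΦ hσ)).symm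

end TangentCalculus

/-! ### Test functions and coordinates on `TM`, differentiated along lifts. -/

section LiftedFields

variable {E : Type*} [NormedAddCommGroup E] [NormedSpace ℝ E]
  {H : Type*} [TopologicalSpace H] {I : ModelWithCorners ℝ E H}
  {M : Type*} [TopologicalSpace M] [ChartedSpace H M] [IsManifold I ∞ M]
  {F : Type*} [NormedAddCommGroup F] [NormedSpace ℝ F]

open VectorField

/-- The vector field on `TM` with horizontal component `X` and vertical component `Y`. -/
noncomputable def fieldLift (cov : CovariantDerivative I E (TangentSpace I : M → Type _))
    (X Y : Π x : M, TangentSpace I x) (P : TangentBundle I M) : TangentSpace I.tangent P :=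
  lift cov P (X P.1) (Y P.1)

theorem mdifferentiableAt_comp_proj {f : M → F} {P : TangentBundle I M}
    (hf : MDifferentiableAt I 𝓘(ℝ, F) f P.1) :
    MDifferentiableAt I.tangent 𝓘(ℝ, F) (fun Q : TangentBundle I M ↦ f Q.1) P :=
  hf.comp P (mdifferentiableAt_proj (TangentSpace I : M → Type _))

theorem eventually_comp_proj {p : M → Prop} {P : TangentBundle I M} (h : ∀ᶠ y in 𝓝 P.1, p y) :
    ∀ᶠ Q : TangentBundle I M in 𝓝 P, p Q.1 :=
  (FiberBundle.continuous_proj E (TangentSpace I : M → Type _)).continuousAt.eventually h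

section Metric

variable (g : ContMDiffRiemannianMetric I ∞ E (fun x : M ↦ TangentSpace I x))

/-- The function `u ↦ g(Z, u)` on `TM` defined by a vector field `Z`. -/
noncomputable def pairing (Z : Π x : M, TangentSpace I x) (Q : TangentBundle I M) : ℝ :=
  g.inner Q.1 (Z Q.1) Q.2

theorem contMDiffAt_pairing {Z : Π x : M, TangentSpace I x} {P : TangentBundle I M}
    (hZ : C2FieldAt Z P.1) : ContMDiffAt I.tangent 𝓘(ℝ, ℝ) 2 (pairing g Z) P :=
  contMDiffAt_metric g (b := fun Q : TangentBundle I M ↦ Q.1) (v := fun Q ↦ Z Q.1) (w := fun Q ↦ Q.2)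
    (ContMDiffAt.comp P hZ (contMDiffAt_proj (TangentSpace I : M → Type _))) contMDiffAt_id

theorem mdifferentiableAt_pairing {Z : Π x : M, TangentSpace I x} {P : TangentBundle I M}
    (hZ : DiffFieldAt Z P.1) : MDifferentiableAt I.tangent 𝓘(ℝ, ℝ) (pairing g Z) P :=
  mdifferentiableAt_metric g (b := fun Q : TangentBundle I M ↦ Q.1) (v := fun Q ↦ Z Q.1)
    (w := fun Q ↦ Q.2)
    (MDifferentiableAt.comp P hZ (mdifferentiableAt_proj (TangentSpace I : M → Type _)))
    mdifferentiableAt_id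

variable {g} {cov : CovariantDerivative I E (TangentSpace I : M → Type _)}

/-- Extend `u` to a field `σ`. Compatibility along `σ` contributes `g(Z, ∇_a σ)` and the fibre
direction `g(Z, b - ∇_a σ)`, so the choice of `σ` drops out. -/
theorem mvfderiv_pairing [FiniteDimensional ℝ E] (hcov : IsLeviCivita g.inner cov) {Z : Π x : M, TangentSpace I x}
    {x : M} (hZ : DiffFieldAt Z x) (u a b : TangentSpace I x) :
    mvfderiv I.tangent (pairing g Z) ⟨x, u⟩ (lift cov ⟨x, u⟩ a b) =
      g.inner x (cov Z x a) u + g.inner x (Z x) b := by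
  obtain ⟨σ, hσ, rfl⟩ : ∃ σ : Π x : M, TangentSpace I x, DiffFieldAt σ x ∧ σ x = u :=
    ⟨FiberBundle.extend E u, (c2FieldAt_extend u).diffFieldAt, FiberBundle.extend_apply_self ..⟩
  have hd : HasDerivAt (fun s : ℝ ↦ pairing g Z ⟨x, σ x + s • (b - cov σ x a)⟩)
      (g.inner x (Z x) (b - cov σ x a)) 0 := by
    have h1 : (fun s : ℝ ↦ pairing g Z ⟨x, σ x + s • (b - cov σ x a)⟩) =
        fun s ↦ g.inner x (Z x) (σ x) + s * g.inner x (Z x) (b - cov σ x a) :=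
      funext fun s ↦ by simp [pairing, map_add, map_smul]
    rw [h1]
    simpa using ((hasDerivAt_id (0 : ℝ)).mul_const (g.inner x (Z x) (b - cov σ x a))).const_add
      (g.inner x (Z x) (σ x))
  rw [mvfderiv_lift cov hσ (mdifferentiableAt_pairing g hZ) hd]
  have h2 := hcov.compatible hZ hσ a
  change mvfderiv I (fun y ↦ g.inner y (Z y) (σ y)) x a + _ = _
  rw [h2, map_sub]
  ring

end Metric

section Coordinates

variable (cov : CovariantDerivative I E (TangentSpace I : M → Type _))

/-- The fibre coordinate on `TM` in the preferred trivialization at `x`. -/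
noncomputable def fibreCoordinate (x : M) (Q : TangentBundle I M) : E :=
  (trivializationAt E (TangentSpace I : M → Type _) x Q).2

theorem contMDiffAt_fibreCoordinate {x : M} {Q : TangentBundle I M}
    (hQ : Q.1 ∈ (trivializationAt E (TangentSpace I : M → Type _) x).baseSet) :
    ContMDiffAt I.tangent 𝓘(ℝ, E) 2 (fibreCoordinate x) Q := by
  let e := trivializationAt E (TangentSpace I : M → Type _) x
  exact ((e.contMDiffAt_iff (IB := I) (IM := I.tangent) (n := 2) (f := id) (x₀ := Q)
    (e.mem_source.2 hQ)).1 contMDiffAt_id).2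

/-- Through `u` passes a field `σ` with constant coefficients in the frame of the trivialization at
`x`. Its fibre coordinate is constant, so only the coordinate of `b - ∇_a σ` survives. Keeping `x`
fixed while `y` varies makes the formula differentiable in the base point. -/
theorem mvfderiv_fibreCoordinate [FiniteDimensional ℝ E] {x y : M}
    (hy : y ∈ (trivializationAt E (TangentSpace I : M → Type _) x).baseSet)
    (u a b : TangentSpace I y) :
    mvfderiv I.tangent (fibreCoordinate x) ⟨y, u⟩ (lift cov ⟨y, u⟩ a b) =
      fibreCoordinate x ⟨y, b⟩ - ∑ i, (Module.finBasis ℝ E).repr (fibreCoordinate x ⟨y, u⟩) i •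
        fibreCoordinate x ⟨y, cov ((trivializationAt E (TangentSpace I : M → Type _) x).localFrame
          (Module.finBasis ℝ E) i) y a⟩ := by
  let e := trivializationAt E (TangentSpace I : M → Type _) x
  let β := Module.finBasis ℝ E
  let s := e.localFrame β
  have hsy : ∀ i, DiffFieldAt (s i) y := fun i ↦
    ((e.isLocalFrameOn_localFrame_baseSet I 2 β).contMDiffAt e.open_baseSet hy i).mdifferentiableAt
      two_ne_zero
  let L : ∀ z, z ∈ e.baseSet → (TangentSpace I z ≃ₗ[ℝ] E) := fun z hz ↦ e.linearEquivAt ℝ z hz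
  have hL : ∀ z hz i, L z hz (s i z) = β i := fun z hz i ↦ by
    have h1 : s i z = (L z hz).symm (β i) := by
      simp only [s]
      rw [e.localFrame_apply_of_mem_baseSet β hz]
      exact β.map_apply _ i
    rw [h1, LinearEquiv.apply_symm_apply]
  let c : Fin _ → ℝ := fun i ↦ β.repr (fibreCoordinate x ⟨y, u⟩) i
  let σ : Π z : M, TangentSpace I z := fun z ↦ ∑ i, c i • s i z
  have hσ : DiffFieldAt σ y := MDifferentiableAt.sum_section fun j _ ↦ (hsy j).smul_const_section
  have hconst : ∀ z ∈ e.baseSet, fibreCoordinate x ⟨z, σ z⟩ = fibreCoordinate x ⟨y, u⟩ := by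
    intro z hz
    change L z hz (∑ i, c i • s i z) = _
    rw [map_sum]
    simp only [map_smul, hL]
    exact β.sum_repr _
  have hu : σ y = u := (L y hy).injective (hconst y hy)
  have hcov : cov σ y a = ∑ i, c i • cov (s i) y a := by
    have := congrArg (fun L : TangentSpace I y →L[ℝ] TangentSpace I y ↦ L a)
      (cov_sum cov Finset.univ c hsy)
    simpa using this
  have hd : HasDerivAt (fun t : ℝ ↦ fibreCoordinate x ⟨y, σ y + t • (b - cov σ y a)⟩)
      (L y hy (b - cov σ y a)) 0 := by
    have h1 : (fun t : ℝ ↦ fibreCoordinate x ⟨y, σ y + t • (b - cov σ y a)⟩) =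
        fun t ↦ L y hy (σ y) + t • L y hy (b - cov σ y a) :=
      funext fun t ↦ by rw [← map_smul, ← map_add]; rfl
    rw [h1]
    simpa using ((hasDerivAt_id (0 : ℝ)).smul_const (L y hy (b - cov σ y a))).const_add (L y hy (σ y))
  have h0 : mvfderiv I (fun z ↦ fibreCoordinate x ⟨z, σ z⟩) y a = 0 := by
    have hev : (fun z ↦ fibreCoordinate x ⟨z, σ z⟩) =ᶠ[𝓝 y] fun _ ↦ fibreCoordinate x ⟨y, u⟩ := by
      filter_upwards [e.open_baseSet.mem_nhds hy] with z hz using hconst z hz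
    have h1 : mfderiv I 𝓘(ℝ, E) (fun z ↦ fibreCoordinate x ⟨z, σ z⟩) y = 0 := by
      rw [hev.mfderiv_eq, mfderiv_const]
      rfl
    exact congrArg (fun L : E →L[ℝ] E ↦ L a) h1
  have hm := mvfderiv_lift cov (a := a) (b := b) hσ
    ((contMDiffAt_fibreCoordinate (Q := ⟨y, σ y⟩) hy).mdifferentiableAt two_ne_zero) hd
  rw [h0, zero_add, map_sub, hcov, map_sum, hu] at hm
  simp only [map_smul] at hm
  exact hm

end Coordinates

end LiftedFields

/-! ### Lie brackets of lifted fields. -/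

section Brackets

variable {E : Type*} [NormedAddCommGroup E] [NormedSpace ℝ E]
  {H : Type*} [TopologicalSpace H] {I : ModelWithCorners ℝ E H}
  {M : Type*} [TopologicalSpace M] [ChartedSpace H M] [IsManifold I ∞ M]
  {g : ContMDiffRiemannianMetric I ∞ E (fun x : M ↦ TangentSpace I x)}
  {cov : CovariantDerivative I E (TangentSpace I : M → Type _)}

open VectorField

theorem mdifferentiableAt_fibreCoordinate_field {X : Π x : M, TangentSpace I x} {x : M}
    (hX : DiffFieldAt X x) :
    MDifferentiableAt I 𝓘(ℝ, E) (fun y ↦ fibreCoordinate x ⟨y, X y⟩) x :=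
  ((mdifferentiableAt_totalSpace I (fun y ↦ (⟨y, X y⟩ : TangentBundle I M))).1 hX).2

variable [FiniteDimensional ℝ E] [I.Boundaryless]

/-- In the chart of `TM` the fibre component of a lift contains the covariant derivatives of a local
frame along `X`; `IsLeviCivita.diffFieldAt_cov` makes these differentiable. -/
theorem IsLeviCivita.diffFieldAt_fieldLift (hcov : IsLeviCivita g.inner cov)
    {X Y : Π x : M, TangentSpace I x} {P : TangentBundle I M} (hX : C2FieldAt X P.1)
    (hY : DiffFieldAt Y P.1) : DiffFieldAt (fieldLift cov X Y) P := by
  have := FiniteDimensional.complete ℝ E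
  let e := trivializationAt E (TangentSpace I : M → Type _) P.1
  let β := Module.finBasis ℝ E
  have hP : P.1 ∈ e.baseSet := FiberBundle.mem_baseSet_trivializationAt' P.1
  have hs : ∀ i, C2FieldAt (e.localFrame β i) P.1 :=
    (e.isLocalFrameOn_localFrame_baseSet I 2 β).contMDiffAt e.open_baseSet hP
  refine diffFieldAt_of_mvfderiv_extChartAt ?_
  have hφ : ContMDiffAt I 𝓘(ℝ, E) 2 (extChartAt I P.1) P.1 := contMDiffAt_extChartAt
  have hF : ContMDiffAt I.tangent 𝓘(ℝ, E) 2 (fibreCoordinate P.1) P :=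
    contMDiffAt_fibreCoordinate hP
  have h1 : MDifferentiableAt I.tangent 𝓘(ℝ, E)
      (fun Q : TangentBundle I M ↦ mvfderiv I (extChartAt I P.1) Q.1 (X Q.1)) P :=
    mdifferentiableAt_comp_proj (f := fun y ↦ mvfderiv I (extChartAt I P.1) y (X y))
      (mdifferentiableAt_mvfderiv_apply hφ hX.diffFieldAt)
  have h2 : MDifferentiableAt I.tangent 𝓘(ℝ, E)
      (fun Q : TangentBundle I M ↦ fibreCoordinate P.1 ⟨Q.1, Y Q.1⟩
        - ∑ i, β.repr (fibreCoordinate P.1 Q) i •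
          fibreCoordinate P.1 ⟨Q.1, cov (e.localFrame β i) Q.1 (X Q.1)⟩) P := by
    refine MDifferentiableAt.sub (mdifferentiableAt_comp_proj
      (f := fun y ↦ fibreCoordinate P.1 ⟨y, Y y⟩) (mdifferentiableAt_fibreCoordinate_field hY)) ?_
    have h3 : ∀ i, MDifferentiableAt I.tangent 𝓘(ℝ, E) ((fun Q : TangentBundle I M ↦
        β.repr (fibreCoordinate P.1 Q) i) •
          fun Q ↦ fibreCoordinate P.1 ⟨Q.1, cov (e.localFrame β i) Q.1 (X Q.1)⟩) P := fun i ↦ by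
      refine MDifferentiableAt.smul ?_ ?_
      · exact ((LinearMap.toContinuousLinearMap (β.coord i)).differentiable.differentiableAt
          (x := fibreCoordinate P.1 P)).mdifferentiableAt.comp P (hF.mdifferentiableAt two_ne_zero)
      · exact mdifferentiableAt_comp_proj
          (f := fun y ↦ fibreCoordinate P.1 ⟨y, cov (e.localFrame β i) y (X y)⟩)
          (mdifferentiableAt_fibreCoordinate_field (hcov.diffFieldAt_cov hX (hs i)))
    refine (MDifferentiableAt.sum (t := Finset.univ) fun i _ ↦ h3 i).congr_of_eventuallyEq
      (Filter.Eventually.of_forall fun Q ↦ ?_)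
    simp [Finset.sum_apply]
  refine (h1.prodMk_space h2).congr_of_eventuallyEq ?_
  have hψ : ContMDiffAt I.tangent 𝓘(ℝ, E × E) 2 (extChartAt I.tangent P) P :=
    contMDiffAt_extChartAt
  filter_upwards [eventually_contMDiffAt hψ, eventually_comp_proj (eventually_contMDiffAt hφ),
    eventually_comp_proj (e.open_baseSet.mem_nhds hP)] with Q hQ hQ' hQe
  have hcomp : ∀ (L : E × E →L[ℝ] E) (ξ : TangentSpace I.tangent Q),
      mvfderiv I.tangent (fun R ↦ L (extChartAt I.tangent P R)) Q ξ =
        L (mvfderiv I.tangent (extChartAt I.tangent P) Q ξ) := fun L ξ ↦ by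
    have h := mfderiv_comp (I := I.tangent) (I' := 𝓘(ℝ, E × E)) (I'' := 𝓘(ℝ, E)) Q
      L.differentiableAt.mdifferentiableAt (hQ.mdifferentiableAt two_ne_zero)
    rw [mfderiv_eq_fderiv, L.fderiv] at h
    exact congrArg (fun A : E × E →L[ℝ] E ↦ A ξ) h
  refine Prod.ext ?_ ?_
  · refine (hcomp (ContinuousLinearMap.fst ℝ E E) _).symm.trans ?_
    refine (mvfderiv_comp_proj (hQ'.mdifferentiableAt two_ne_zero) _).trans ?_
    exact congrArg _ (dproj_lift cov Q _ _)
  · refine (hcomp (ContinuousLinearMap.snd ℝ E E) _).symm.trans ?_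
    exact mvfderiv_fibreCoordinate cov hQe Q.2 _ _

/-- On functions pulled back from `M` a lift acts as its horizontal part `X`. Testing on the chart
at `x` is enough, since its differential is injective. -/
theorem dproj_mlieBracket_fieldLift (hcov : IsLeviCivita g.inner cov)
    {X Y X' Y' : Π x : M, TangentSpace I x} {x : M} (hX : C2FieldAt X x) (hY : C2FieldAt Y x)
    (hX' : C2FieldAt X' x) (hY' : C2FieldAt Y' x) (u : TangentSpace I x) :
    dproj I ⟨x, u⟩ (mlieBracket I.tangent (fieldLift cov X Y) (fieldLift cov X' Y') ⟨x, u⟩) =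
      mlieBracket I X X' x := by
  have := FiniteDimensional.complete ℝ E
  have hφ : ContMDiffAt I 𝓘(ℝ, E) 2 (extChartAt I x) x := contMDiffAt_extChartAt
  have hφ' := hφ.comp (⟨x, u⟩ : TangentBundle I M)
    (contMDiffAt_proj (TangentSpace I : M → Type _))
  have hev : ∀ X Y : Π x : M, TangentSpace I x,
      ∀ᶠ Q : TangentBundle I M in 𝓝 ⟨x, u⟩,
        mvfderiv I.tangent (fun R : TangentBundle I M ↦ extChartAt I x R.1) Q (fieldLift cov X Y Q) =
          mvfderiv I (extChartAt I x) Q.1 (X Q.1) := fun X Y ↦ by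
    filter_upwards [eventually_comp_proj (P := (⟨x, u⟩ : TangentBundle I M))
      (eventually_contMDiffAt hφ)] with Q hQ
    rw [mvfderiv_comp_proj (hQ.mdifferentiableAt two_ne_zero), fieldLift, dproj_lift]
  have hdd : ∀ {X Y X' Y' : Π x : M, TangentSpace I x}, C2FieldAt X' x →
      mvfderiv I.tangent (fun Q ↦ mvfderiv I.tangent (fun R : TangentBundle I M ↦ extChartAt I x R.1)
        Q (fieldLift cov X' Y' Q)) ⟨x, u⟩ (fieldLift cov X Y ⟨x, u⟩) =
      mvfderiv I (fun y ↦ mvfderiv I (extChartAt I x) y (X' y)) x (X x) := by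
    intro X Y X' Y' hX'
    have h1 := mvfderiv_comp_proj (Q := (⟨x, u⟩ : TangentBundle I M))
      (mdifferentiableAt_mvfderiv_apply hφ hX'.diffFieldAt) (fieldLift cov X Y ⟨x, u⟩)
    rw [fieldLift, dproj_lift] at h1
    refine Eq.trans ?_ h1
    exact congrArg (fun L : E × E →L[ℝ] E ↦ L _) (Filter.EventuallyEq.mfderiv_eq (hev X' Y'))
  have h1 := mvfderiv_mlieBracket hφ' (hcov.diffFieldAt_fieldLift (P := ⟨x, u⟩) hX hY.diffFieldAt)
    (hcov.diffFieldAt_fieldLift (P := ⟨x, u⟩) hX' hY'.diffFieldAt)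
  have h2 := mvfderiv_mlieBracket hφ hX.diffFieldAt hX'.diffFieldAt
  have h3 := mvfderiv_comp_proj (Q := (⟨x, u⟩ : TangentBundle I M))
    (hφ.mdifferentiableAt two_ne_zero)
    (mlieBracket I.tangent (fieldLift cov X Y) (fieldLift cov X' Y') ⟨x, u⟩)
  have h4 := (h3.symm.trans h1).trans
    ((congrArg₂ (· - ·) (hdd (Y := Y) (Y' := Y') hX') (hdd (Y := Y') (Y' := Y) hX)).trans h2.symm)
  obtain ⟨A, hA⟩ := isInvertible_mfderiv_extChartAt (I := I) (mem_extChartAt_source (I := I) x)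
  refine A.injective ?_
  have hA' : ∀ v : TangentSpace I x, A v = mvfderiv I (extChartAt I x) x v := fun v ↦
    congrArg (fun L : E →L[ℝ] E ↦ L v) hA
  exact (hA' _).trans (h4.trans (hA' _).symm)

/-- The vertical component of the Lie bracket of two vector fields on `TM`. -/
theorem metric_connectionMap_mlieBracket_fieldLift (hcov : IsLeviCivita g.inner cov)
    {X Y X' Y' Z : Π x : M, TangentSpace I x} {x : M} (hX : C2FieldAt X x) (hY : C2FieldAt Y x)
    (hX' : C2FieldAt X' x) (hY' : C2FieldAt Y' x) (hZ : C2FieldAt Z x) (u : TangentSpace I x) :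
    g.inner x (Z x) (connectionMap cov ⟨x, u⟩
      (mlieBracket I.tangent (fieldLift cov X Y) (fieldLift cov X' Y') ⟨x, u⟩)) =
      g.inner x (curvatureField cov X X' Z x) u
        + g.inner x (Z x) (cov Y' x (X x) - cov Y x (X' x)) := by
  have := FiniteDimensional.complete ℝ E
  have hθ := contMDiffAt_pairing g (P := ⟨x, u⟩) hZ
  -- A lift sends a pairing to another pairing plus a function on `M`, so a second derivative can be
  -- taken in the same way.
  have hev : ∀ X Y : Π x : M, TangentSpace I x,
      ∀ᶠ Q : TangentBundle I M in 𝓝 ⟨x, u⟩,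
        mvfderiv I.tangent (pairing g Z) Q (fieldLift cov X Y Q) =
          pairing g (fun y ↦ cov Z y (X y)) Q + g.inner Q.1 (Z Q.1) (Y Q.1) := fun X Y ↦ by
    filter_upwards [eventually_comp_proj (P := (⟨x, u⟩ : TangentBundle I M)) hZ.eventually]
      with Q hQ
    exact mvfderiv_pairing hcov hQ.diffFieldAt Q.2 _ _
  have hdd : ∀ {X Y X' Y' : Π x : M, TangentSpace I x}, C2FieldAt X' x → C2FieldAt Y' x →
      mvfderiv I.tangent (fun Q ↦ mvfderiv I.tangent (pairing g Z) Q (fieldLift cov X' Y' Q))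
        ⟨x, u⟩ (fieldLift cov X Y ⟨x, u⟩) =
      g.inner x (cov (fun y ↦ cov Z y (X' y)) x (X x)) u + g.inner x (cov Z x (X' x)) (Y x)
        + (g.inner x (cov Z x (X x)) (Y' x) + g.inner x (Z x) (cov Y' x (X x))) := by
    intro X Y X' Y' hX' hY'
    have hc := hcov.diffFieldAt_cov hX' hZ
    have h0 := mdifferentiableAt_metric g hZ.diffFieldAt hY'.diffFieldAt
    have h1 := mvfderiv_comp_proj (Q := (⟨x, u⟩ : TangentBundle I M)) h0 (fieldLift cov X Y ⟨x, u⟩)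
    rw [fieldLift, dproj_lift, hcov.compatible hZ.diffFieldAt hY'.diffFieldAt] at h1
    have h2 := mvfderiv_pairing hcov hc u (X x) (Y x)
    have h3 := mvfderiv_add (mdifferentiableAt_pairing g (P := ⟨x, u⟩) hc)
      (mdifferentiableAt_comp_proj (P := (⟨x, u⟩ : TangentBundle I M)) h0)
    have h4 := congrArg (fun L : E × E →L[ℝ] ℝ ↦ L (fieldLift cov X Y ⟨x, u⟩)) h3
    refine Eq.trans ?_ (h4.trans (congrArg₂ (· + ·) h2 h1))
    exact congrArg (fun L : E × E →L[ℝ] ℝ ↦ L _) (Filter.EventuallyEq.mfderiv_eq (hev X' Y'))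
  have h1 := mvfderiv_mlieBracket hθ (hcov.diffFieldAt_fieldLift (P := ⟨x, u⟩) hX hY.diffFieldAt)
    (hcov.diffFieldAt_fieldLift (P := ⟨x, u⟩) hX' hY'.diffFieldAt)
  -- The mixed terms `g(∇_X Z, Y')` and `g(∇_{X'} Z, Y)` occur in both orders and cancel; the second
  -- covariant derivatives of `Z` combine with `∇_{[X,X']} Z` into curvature.
  rw [hdd hX' hY', hdd hX hY, eq_lift cov ⟨x, u⟩ (mlieBracket I.tangent _ _ _),
    mvfderiv_pairing hcov hZ.diffFieldAt, dproj_mlieBracket_fieldLift hcov hX hY hX' hY'] at h1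
  simp only [curvatureField, map_sub, sub_apply] at h1 ⊢
  linarith

end Brackets

/-! ### Symmetries and tensoriality of the curvature. -/

section CurvatureSymmetries

variable {E : Type*} [NormedAddCommGroup E] [NormedSpace ℝ E]
  {H : Type*} [TopologicalSpace H] {I : ModelWithCorners ℝ E H}
  {M : Type*} [TopologicalSpace M] [ChartedSpace H M] [IsManifold I ∞ M]
  {g : ContMDiffRiemannianMetric I ∞ E (fun x : M ↦ TangentSpace I x)}
  {cov : CovariantDerivative I E (TangentSpace I : M → Type _)}

open VectorField

theorem curvatureField_swap (X Y Z : Π x : M, TangentSpace I x) (x : M) :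
    curvatureField cov X Y Z x = -curvatureField cov Y X Z x := by
  simp only [curvatureField]
  rw [mlieBracket_swap_apply, map_neg]
  abel

theorem curvature_swap (x : M) (a b c : TangentSpace I x) :
    curvature cov x a b c = -curvature cov x b a c :=
  curvatureField_swap _ _ _ x

variable [FiniteDimensional ℝ E] [I.Boundaryless]

/-- Apply `[X,Y]`, as a commutator of derivations, to the function `g(Z,W)` and expand by
compatibility: the mixed terms are symmetric in `X`, `Y`. -/
theorem IsLeviCivita.metric_curvatureField_skew (hcov : IsLeviCivita g.inner cov)
    {X Y Z W : Π x : M, TangentSpace I x} {x : M} (hX : C2FieldAt X x) (hY : C2FieldAt Y x)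
    (hZ : C2FieldAt Z x) (hW : C2FieldAt W x) :
    g.inner x (curvatureField cov X Y Z x) (W x) =
      -g.inner x (curvatureField cov X Y W x) (Z x) := by
  have := FiniteDimensional.complete ℝ E
  have hf := contMDiffAt_metric g hZ hW
  have hdd : ∀ {X Y : Π x : M, TangentSpace I x}, C2FieldAt X x → C2FieldAt Y x →
      mvfderiv I (fun y ↦ mvfderiv I (fun y ↦ g.inner y (Z y) (W y)) y (Y y)) x (X x) =
        g.inner x (cov (fun y ↦ cov Z y (Y y)) x (X x)) (W x)
          + g.inner x (cov Z x (Y x)) (cov W x (X x))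
          + (g.inner x (cov Z x (X x)) (cov W x (Y x))
            + g.inner x (Z x) (cov (fun y ↦ cov W y (Y y)) x (X x))) := by
    intro X Y hX hY
    have hZ' := hcov.diffFieldAt_cov hY hZ
    have hW' := hcov.diffFieldAt_cov hY hW
    have hev : (fun y ↦ mvfderiv I (fun y ↦ g.inner y (Z y) (W y)) y (Y y)) =ᶠ[𝓝 x]
        (fun y ↦ g.inner y (cov Z y (Y y)) (W y)) + fun y ↦ g.inner y (Z y) (cov W y (Y y)) := by
      filter_upwards [hZ.eventually, hW.eventually] with y hZ hW
      exact hcov.compatible hZ.diffFieldAt hW.diffFieldAt _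
    have h1 := mvfderiv_add (mdifferentiableAt_metric g hZ' hW.diffFieldAt)
      (mdifferentiableAt_metric g hZ.diffFieldAt hW')
    have h2 := congrArg (fun L : E →L[ℝ] ℝ ↦ L (X x)) h1
    refine (congrArg (fun L : E →L[ℝ] ℝ ↦ L (X x)) hev.mfderiv_eq).trans (h2.trans ?_)
    exact congrArg₂ (· + ·) (hcov.compatible hZ' hW.diffFieldAt _)
      (hcov.compatible hZ.diffFieldAt hW' _)
  have h1 := mvfderiv_mlieBracket hf hX.diffFieldAt hY.diffFieldAt
  rw [hdd hX hY, hdd hY hX, hcov.compatible hZ.diffFieldAt hW.diffFieldAt] at h1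
  rw [g.symm x (curvatureField cov X Y W x)]
  simp only [curvatureField, map_sub, sub_apply]
  linarith

/-- The first Bianchi identity. -/
theorem IsLeviCivita.curvatureField_cyclic (hcov : IsLeviCivita g.inner cov)
    {X Y Z : Π x : M, TangentSpace I x} {x : M} (hX : C2FieldAt X x) (hY : C2FieldAt Y x)
    (hZ : C2FieldAt Z x) :
    curvatureField cov X Y Z x + curvatureField cov Y Z X x + curvatureField cov Z X Y x = 0 := by
  have := FiniteDimensional.complete ℝ E
  have hc : IsCovariantDerivativeOn E cov Set.univ := cov.isCovariantDerivativeOn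
  -- Torsion-freeness is used twice, for `Y`, `Z` and then for `X`, `[Y,Z]`. In the cyclic sum the
  -- covariant derivatives cancel and the Jacobi identity remains.
  have key : ∀ {X Y Z : Π x : M, TangentSpace I x}, C2FieldAt X x → C2FieldAt Y x → C2FieldAt Z x →
      cov (fun y ↦ cov Z y (Y y)) x (X x) = cov (fun y ↦ cov Y y (Z y)) x (X x)
        + cov X x (mlieBracket I Y Z x) + mlieBracket I X (mlieBracket I Y Z) x := by
    intro X Y Z hX hY hZ
    have hB := hY.mlieBracket hZ
    have h0 := hcov.diffFieldAt_cov hZ hY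
    have h1 : cov (fun y ↦ cov Z y (Y y)) x =
        cov ((fun y ↦ cov Y y (Z y)) + mlieBracket I Y Z) x := by
      refine hc.congr_of_eventuallyEq (hcov.diffFieldAt_cov hY hZ)
        (mdifferentiableAt_add_section h0 hB) Filter.univ_mem ?_
      filter_upwards [hY.eventually, hZ.eventually] with y hY hZ
      rw [Pi.add_apply, ← hcov.cov_sub_cov hY.diffFieldAt hZ.diffFieldAt]
      abel
    have h2 := hcov.cov_sub_cov hX.diffFieldAt hB
    have h3 := congrArg (fun L : TangentSpace I x →L[ℝ] TangentSpace I x ↦ L (X x))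
      (h1.trans (hc.add h0 hB))
    rw [← h2]
    refine h3.trans ?_
    simp only [add_apply]
    abel
  have : IsManifold I (minSmoothness ℝ 3) M := by
    rw [minSmoothness_of_isRCLikeNormedField]; infer_instance
  have hJ := leibniz_identity_mlieBracket_apply (I := I) (U := X) (V := Y) (W := Z) (x := x)
    (by rwa [minSmoothness_of_isRCLikeNormedField]) (by rwa [minSmoothness_of_isRCLikeNormedField])
    (by rwa [minSmoothness_of_isRCLikeNormedField])
  have h1 : mlieBracket I Z (mlieBracket I X Y) x = -mlieBracket I (mlieBracket I X Y) Z x :=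
    mlieBracket_swap_apply
  have h2 : mlieBracket I Y (mlieBracket I Z X) x = -mlieBracket I Y (mlieBracket I X Z) x := by
    have h3 : mlieBracket I Z X = (-1 : ℝ) • mlieBracket I X Z := by
      rw [mlieBracket_swap, neg_one_smul]
    rw [h3, mlieBracket_const_smul_right (hX.mlieBracket hZ), neg_one_smul]
  simp only [curvatureField]
  rw [key hX hY hZ, key hY hZ hX, key hZ hX hY, h1, h2, hJ]
  abel

/-- The classical octahedron argument: four Bianchi identities, one for each omitted field, combined
through the two skew symmetries. -/
theorem IsLeviCivita.metric_curvatureField_pair (hcov : IsLeviCivita g.inner cov)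
    {X Y Z W : Π x : M, TangentSpace I x} {x : M} (hX : C2FieldAt X x) (hY : C2FieldAt Y x)
    (hZ : C2FieldAt Z x) (hW : C2FieldAt W x) :
    g.inner x (curvatureField cov X Y Z x) (W x) =
      g.inner x (curvatureField cov Z W X x) (Y x) := by
  have hb : ∀ {X Y Z W : Π x : M, TangentSpace I x}, C2FieldAt X x → C2FieldAt Y x →
      C2FieldAt Z x → g.inner x (curvatureField cov X Y Z x) (W x)
        + g.inner x (curvatureField cov Y Z X x) (W x)
        + g.inner x (curvatureField cov Z X Y x) (W x) = 0 := by
    intro X Y Z W hX hY hZ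
    have h := congrArg (fun v ↦ g.inner x v (W x)) (hcov.curvatureField_cyclic hX hY hZ)
    simpa using h
  have hs : ∀ X Y Z W : Π x : M, TangentSpace I x, g.inner x (curvatureField cov X Y Z x) (W x) =
      -g.inner x (curvatureField cov Y X Z x) (W x) := by
    intro X Y Z W
    rw [curvatureField_swap, map_neg, neg_apply]
  have b1 := hb (W := W) hX hY hZ
  have b2 := hb (W := X) hY hZ hW
  have b3 := hb (W := Y) hZ hW hX
  have b4 := hb (W := Z) hW hX hY
  have k1 := hcov.metric_curvatureField_skew hX hY hZ hW
  have k2 := hcov.metric_curvatureField_skew hY hZ hX hW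
  have k3 := hcov.metric_curvatureField_skew hZ hX hY hW
  have k4 := hcov.metric_curvatureField_skew hW hX hY hZ
  have k5 := hcov.metric_curvatureField_skew hW hY hX hZ
  have k6 := hcov.metric_curvatureField_skew hZ hW hX hY
  have s1 := hs W Y X Z
  have s2 := hs W Y Z X
  have s3 := hs X Z W Y
  have s4 := hs X W Z Y
  have s5 := hs X W Y Z
  have s6 := hs Z X W Y
  linarith

/-- The curvature of vector fields only depends on their values. -/
theorem IsLeviCivita.curvatureField_congr (hcov : IsLeviCivita g.inner cov)
    {X Y Z X' Y' Z' : Π x : M, TangentSpace I x} {x : M} (hX : C2FieldAt X x) (hY : C2FieldAt Y x)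
    (hZ : C2FieldAt Z x) (hX' : C2FieldAt X' x) (hY' : C2FieldAt Y' x) (hZ' : C2FieldAt Z' x)
    (hXX : X x = X' x) (hYY : Y x = Y' x) (hZZ : Z x = Z' x) :
    curvatureField cov X Y Z x = curvatureField cov X' Y' Z' x := by
  -- The bracket of the lifts does not involve `Z`, and its formula shows that `g(R(X,Y)Z, c)`
  -- depends on `Z` through `Z x` alone.
  have h3 : ∀ {X Y Z Z' : Π x : M, TangentSpace I x}, C2FieldAt X x → C2FieldAt Y x →
      C2FieldAt Z x → C2FieldAt Z' x → Z x = Z' x →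
      curvatureField cov X Y Z x = curvatureField cov X Y Z' x := by
    intro X Y Z Z' hX hY hZ hZ' h
    refine metric_ext g fun c ↦ ?_
    have e1 := metric_connectionMap_mlieBracket_fieldLift hcov hX hX hY hY hZ c
    have e2 := metric_connectionMap_mlieBracket_fieldLift hcov hX hX hY hY hZ' c
    rw [h] at e1
    linarith
  -- Pair symmetry moves the first slot to the third.
  have h1 : ∀ {X X' Y Z : Π x : M, TangentSpace I x}, C2FieldAt X x → C2FieldAt X' x →
      C2FieldAt Y x → C2FieldAt Z x → X x = X' x →
      curvatureField cov X Y Z x = curvatureField cov X' Y Z x := by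
    intro X X' Y Z hX hX' hY hZ h
    refine metric_ext g fun c ↦ ?_
    have hc := c2FieldAt_extend c
    have e1 := hcov.metric_curvatureField_pair hX hY hZ hc
    have e2 := hcov.metric_curvatureField_pair hX' hY hZ hc
    rw [FiberBundle.extend_apply_self] at e1 e2
    rw [e1, e2, h3 hZ hc hX hX' h]
  rw [h1 hX hX' hY hZ hXX, curvatureField_swap, h1 hY hY' hX' hZ hYY, ← curvatureField_swap,
    h3 hX' hY' hZ hZ' hZZ]

theorem IsLeviCivita.curvature_eq (hcov : IsLeviCivita g.inner cov)
    {X Y Z : Π x : M, TangentSpace I x} {x : M} (hX : C2FieldAt X x) (hY : C2FieldAt Y x)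
    (hZ : C2FieldAt Z x) :
    curvature cov x (X x) (Y x) (Z x) = curvatureField cov X Y Z x :=
  hcov.curvatureField_congr (c2FieldAt_extend _) (c2FieldAt_extend _) (c2FieldAt_extend _) hX hY hZ
    (FiberBundle.extend_apply_self ..) (FiberBundle.extend_apply_self ..)
    (FiberBundle.extend_apply_self ..)

theorem IsLeviCivita.metric_curvature_skew (hcov : IsLeviCivita g.inner cov) (x : M)
    (a b c d : TangentSpace I x) :
    g.inner x (curvature cov x a b c) d = -g.inner x (curvature cov x a b d) c := by
  have h := hcov.metric_curvatureField_skew (c2FieldAt_extend a) (c2FieldAt_extend b)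
    (c2FieldAt_extend c) (c2FieldAt_extend d)
  rwa [FiberBundle.extend_apply_self, FiberBundle.extend_apply_self] at h

theorem IsLeviCivita.metric_curvature_pair (hcov : IsLeviCivita g.inner cov) (x : M)
    (a b c d : TangentSpace I x) :
    g.inner x (curvature cov x a b c) d = g.inner x (curvature cov x c d a) b := by
  have h := hcov.metric_curvatureField_pair (c2FieldAt_extend a) (c2FieldAt_extend b)
    (c2FieldAt_extend c) (c2FieldAt_extend d)
  rwa [FiberBundle.extend_apply_self, FiberBundle.extend_apply_self] at h

theorem IsLeviCivita.curvature_cyclic (hcov : IsLeviCivita g.inner cov) (x : M)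
    (a b c : TangentSpace I x) :
    curvature cov x a b c + curvature cov x b c a + curvature cov x c a b = 0 :=
  hcov.curvatureField_cyclic (c2FieldAt_extend a) (c2FieldAt_extend b) (c2FieldAt_extend c)

end CurvatureSymmetries

section LinearityOfDifferential

variable {E : Type*} [NormedAddCommGroup E] [NormedSpace ℝ E]
  {H : Type*} [TopologicalSpace H] {I : ModelWithCorners ℝ E H}
  {M : Type*} [TopologicalSpace M] [ChartedSpace H M]

theorem mvfderiv_const_mul (m : ℝ) {f : M → ℝ} {x : M} (hf : MDifferentiableAt I 𝓘(ℝ, ℝ) f x)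
    (v : TangentSpace I x) : mvfderiv I (fun y ↦ m * f y) x v = m * mvfderiv I f x v := by
  have h := mvfderiv_mul (I := I) (mdifferentiableAt_const (c := m)) hf
  rw [mvfderiv_const, smul_zero, add_zero] at h
  exact congrArg (fun L : E →L[ℝ] ℝ ↦ L v) h

end LinearityOfDifferential

/-! ### The Koszul formula for the metric on `TM`. -/

section LeviCivitaOfTangentMetric

variable {E : Type*} [NormedAddCommGroup E] [NormedSpace ℝ E]
  {H : Type*} [TopologicalSpace H] {I : ModelWithCorners ℝ E H}
  {M : Type*} [TopologicalSpace M] [ChartedSpace H M] [IsManifold I ∞ M]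
  {g : ContMDiffRiemannianMetric I ∞ E (fun x : M ↦ TangentSpace I x)}
  {cov : CovariantDerivative I E (TangentSpace I : M → Type _)}

open VectorField

theorem metric_lift_right (m₁ m₂ m₃ : ℝ) (P : TangentBundle I M) (ξ : TangentSpace I.tangent P)
    (c d : TangentSpace I P.1) :
    metric g.inner cov m₁ m₂ m₃ P ξ (lift cov P c d) =
      m₁ * g.inner P.1 (dproj I P ξ) c
        + m₂ * (g.inner P.1 (dproj I P ξ) d + g.inner P.1 (connectionMap cov P ξ) c)
        + m₃ * g.inner P.1 (connectionMap cov P ξ) d := by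
  rw [metric_apply, dproj_lift, connectionMap_lift]

theorem metric_symm (m₁ m₂ m₃ : ℝ) (P : TangentBundle I M) (ξ η : TangentSpace I.tangent P) :
    metric g.inner cov m₁ m₂ m₃ P ξ η = metric g.inner cov m₁ m₂ m₃ P η ξ := by
  rw [metric_apply, metric_apply, g.symm P.1 (dproj I P ξ) (dproj I P η),
    g.symm P.1 (dproj I P ξ) (connectionMap cov P η),
    g.symm P.1 (connectionMap cov P ξ) (dproj I P η),
    g.symm P.1 (connectionMap cov P ξ) (connectionMap cov P η)]
  ring

variable [FiniteDimensional ℝ E]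

/-- The product of two lifts depends on the base point only, so just the horizontal part `X₁`
differentiates it, and compatibility of `g` does the rest. -/
theorem IsLeviCivita.mvfderiv_metric_fieldLift (hcov : IsLeviCivita g.inner cov) (m₁ m₂ m₃ : ℝ)
    {X₁ Y₁ X₂ Y₂ X₃ Y₃ : Π x : M, TangentSpace I x} {x : M}
    (hX₂ : DiffFieldAt X₂ x) (hY₂ : DiffFieldAt Y₂ x) (hX₃ : DiffFieldAt X₃ x)
    (hY₃ : DiffFieldAt Y₃ x) (u : TangentSpace I x) :
    mvfderiv I.tangent (fun Q ↦ metric g.inner cov m₁ m₂ m₃ Q (fieldLift cov X₂ Y₂ Q)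
        (fieldLift cov X₃ Y₃ Q)) ⟨x, u⟩ (fieldLift cov X₁ Y₁ ⟨x, u⟩) =
      m₁ * (g.inner x (cov X₂ x (X₁ x)) (X₃ x) + g.inner x (X₂ x) (cov X₃ x (X₁ x)))
        + m₂ * (g.inner x (cov X₂ x (X₁ x)) (Y₃ x) + g.inner x (X₂ x) (cov Y₃ x (X₁ x))
          + (g.inner x (cov Y₂ x (X₁ x)) (X₃ x) + g.inner x (Y₂ x) (cov X₃ x (X₁ x))))
        + m₃ * (g.inner x (cov Y₂ x (X₁ x)) (Y₃ x) + g.inner x (Y₂ x) (cov Y₃ x (X₁ x))) := by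
  have h0 : (fun Q ↦ metric g.inner cov m₁ m₂ m₃ Q (fieldLift cov X₂ Y₂ Q)
        (fieldLift cov X₃ Y₃ Q)) = fun Q : TangentBundle I M ↦
      (fun y ↦ m₁ * g.inner y (X₂ y) (X₃ y) + m₂ * (g.inner y (X₂ y) (Y₃ y)
        + g.inner y (Y₂ y) (X₃ y)) + m₃ * g.inner y (Y₂ y) (Y₃ y)) Q.1 := by
    funext Q
    simp only [fieldLift, metric_lift_right, dproj_lift, connectionMap_lift]
  have hm : ∀ {A B : Π x : M, TangentSpace I x}, DiffFieldAt A x → DiffFieldAt B x →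
      MDifferentiableAt I 𝓘(ℝ, ℝ) (fun y ↦ g.inner y (A y) (B y)) x := mdifferentiableAt_metric g
  have hc : ∀ (m : ℝ) {f : M → ℝ}, MDifferentiableAt I 𝓘(ℝ, ℝ) f x →
      MDifferentiableAt I 𝓘(ℝ, ℝ) (fun y ↦ m * f y) x := fun m f hf ↦
    MDifferentiableAt.mul mdifferentiableAt_const hf
  have h1 := hc m₁ (hm hX₂ hX₃)
  have h2 := (hm hX₂ hY₃).add (hm hY₂ hX₃)
  have h3 := hc m₃ (hm hY₂ hY₃)
  have h4 := mvfderiv_comp_proj (Q := (⟨x, u⟩ : TangentBundle I M)) ((h1.add (hc m₂ h2)).add h3)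
    (fieldLift cov X₁ Y₁ ⟨x, u⟩)
  rw [mvfderiv_add (h1.add (hc m₂ h2)) h3, mvfderiv_add h1 (hc m₂ h2), fieldLift, dproj_lift,
    add_apply, add_apply, mvfderiv_const_mul m₁ (hm hX₂ hX₃), mvfderiv_const_mul m₂ h2,
    mvfderiv_const_mul m₃ (hm hY₂ hY₃), mvfderiv_add (hm hX₂ hY₃) (hm hY₂ hX₃), add_apply,
    hcov.compatible hX₂ hX₃, hcov.compatible hX₂ hY₃, hcov.compatible hY₂ hX₃,
    hcov.compatible hY₂ hY₃] at h4
  rw [h0]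
  exact h4

variable [I.Boundaryless] {m₁ m₂ m₃ : ℝ}
  {covT : CovariantDerivative I.tangent (E × E) (TangentSpace I.tangent : TangentBundle I M → Type _)}

/-- Each bracket adds one curvature vector, which is vertical, so it meets the horizontal part of
the remaining field with weight `m₂` and the vertical part with weight `m₃`. Everything else
collapses as for a metric connection without torsion. -/
theorem IsLeviCivita.koszul_fieldLift (hcov : IsLeviCivita g.inner cov)
    (hcovT : IsLeviCivita (metric g.inner cov m₁ m₂ m₃) covT)
    {X₁ Y₁ X₂ Y₂ X₃ Y₃ : Π x : M, TangentSpace I x} {x : M}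
    (hX₁ : C2FieldAt X₁ x) (hY₁ : C2FieldAt Y₁ x) (hX₂ : C2FieldAt X₂ x) (hY₂ : C2FieldAt Y₂ x)
    (hX₃ : C2FieldAt X₃ x) (hY₃ : C2FieldAt Y₃ x) (u : TangentSpace I x)
    {h v : TangentSpace I x}
    (hh : h = dproj I ⟨x, u⟩ (covT (fieldLift cov X₂ Y₂) ⟨x, u⟩ (fieldLift cov X₁ Y₁ ⟨x, u⟩)))
    (hv : v = connectionMap cov ⟨x, u⟩
      (covT (fieldLift cov X₂ Y₂) ⟨x, u⟩ (fieldLift cov X₁ Y₁ ⟨x, u⟩))) :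
    2 * (m₁ * g.inner x h (X₃ x) + m₂ * (g.inner x h (Y₃ x) + g.inner x v (X₃ x))
        + m₃ * g.inner x v (Y₃ x)) =
      2 * (m₁ * g.inner x (cov X₂ x (X₁ x)) (X₃ x)
        + m₂ * (g.inner x (cov X₂ x (X₁ x)) (Y₃ x) + g.inner x (cov Y₂ x (X₁ x)) (X₃ x))
        + m₃ * g.inner x (cov Y₂ x (X₁ x)) (Y₃ x))
      + (m₂ * g.inner x (curvatureField cov X₁ X₂ X₃ x) u
        + m₃ * g.inner x (curvatureField cov X₁ X₂ Y₃ x) u)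
      - (m₂ * g.inner x (curvatureField cov X₂ X₃ X₁ x) u
        + m₃ * g.inner x (curvatureField cov X₂ X₃ Y₁ x) u)
      + (m₂ * g.inner x (curvatureField cov X₃ X₁ X₂ x) u
        + m₃ * g.inner x (curvatureField cov X₃ X₁ Y₂ x) u) := by
  have hD : ∀ {X Y : Π x : M, TangentSpace I x}, C2FieldAt X x → C2FieldAt Y x →
      DiffFieldAt (fieldLift cov X Y) (⟨x, u⟩ : TangentBundle I M) := fun hX hY ↦
    hcov.diffFieldAt_fieldLift (P := ⟨x, u⟩) hX hY.diffFieldAt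
  have hk := hcovT.koszul (metric_symm m₁ m₂ m₃) (hD hX₁ hY₁) (hD hX₂ hY₂) (hD hX₃ hY₃)
  have hB : ∀ {X Y X' Y' X'' Y'' : Π x : M, TangentSpace I x}, C2FieldAt X x → C2FieldAt Y x →
      C2FieldAt X' x → C2FieldAt Y' x → C2FieldAt X'' x → C2FieldAt Y'' x →
      metric g.inner cov m₁ m₂ m₃ ⟨x, u⟩ (mlieBracket I.tangent (fieldLift cov X Y)
        (fieldLift cov X' Y') ⟨x, u⟩) (fieldLift cov X'' Y'' ⟨x, u⟩) =
      m₁ * (g.inner x (X'' x) (cov X' x (X x)) - g.inner x (X'' x) (cov X x (X' x)))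
        + m₂ * ((g.inner x (Y'' x) (cov X' x (X x)) - g.inner x (Y'' x) (cov X x (X' x)))
          + (g.inner x (curvatureField cov X X' X'' x) u
            + (g.inner x (X'' x) (cov Y' x (X x)) - g.inner x (X'' x) (cov Y x (X' x)))))
        + m₃ * (g.inner x (curvatureField cov X X' Y'' x) u
            + (g.inner x (Y'' x) (cov Y' x (X x)) - g.inner x (Y'' x) (cov Y x (X' x)))) := by
    intro X Y X' Y' X'' Y'' hX hY hX' hY' hX'' hY''
    rw [fieldLift.eq_1 cov X'' Y'', metric_lift_right, g.symm x (connectionMap _ _ _) (X'' x),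
      g.symm x (connectionMap _ _ _) (Y'' x),
      metric_connectionMap_mlieBracket_fieldLift hcov hX hY hX' hY' hX'' u,
      metric_connectionMap_mlieBracket_fieldLift hcov hX hY hX' hY' hY'' u,
      dproj_mlieBracket_fieldLift hcov hX hY hX' hY' u,
      ← hcov.cov_sub_cov hX.diffFieldAt hX'.diffFieldAt, g.symm x (_ - _) (X'' x),
      g.symm x (_ - _) (Y'' x)]
    simp only [map_sub]
  rw [hcov.mvfderiv_metric_fieldLift m₁ m₂ m₃ (X₁ := X₁) (Y₁ := Y₁) hX₂.diffFieldAt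
      hY₂.diffFieldAt hX₃.diffFieldAt hY₃.diffFieldAt u,
    hcov.mvfderiv_metric_fieldLift m₁ m₂ m₃ (X₁ := X₂) (Y₁ := Y₂) hX₁.diffFieldAt
      hY₁.diffFieldAt hX₃.diffFieldAt hY₃.diffFieldAt u,
    hcov.mvfderiv_metric_fieldLift m₁ m₂ m₃ (X₁ := X₃) (Y₁ := Y₃) hX₁.diffFieldAt
      hY₁.diffFieldAt hX₂.diffFieldAt hY₂.diffFieldAt u,
    metric_symm _ _ _ _ (fieldLift cov X₁ Y₁ _), metric_symm _ _ _ _ (fieldLift cov X₂ Y₂ _),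
    hB hX₁ hY₁ hX₂ hY₂ hX₃ hY₃, hB hX₂ hY₂ hX₃ hY₃ hX₁ hY₁, hB hX₃ hY₃ hX₁ hY₁ hX₂ hY₂,
    fieldLift.eq_1 cov X₃ Y₃, metric_lift_right, ← hh, ← hv] at hk
  refine hk.trans ?_
  have hs : ∀ (A : Π x : M, TangentSpace I x) (B C : Π x : M, TangentSpace I x),
      g.inner x (cov A x (B x)) (C x) = g.inner x (C x) (cov A x (B x)) := fun A B C ↦ g.symm _ _ _
  simp only [hs]
  ring

end LeviCivitaOfTangentMetric

/-! ### Vanishing of the curvature on zero arguments. -/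

section CurvatureZero

variable {E : Type*} [NormedAddCommGroup E] [NormedSpace ℝ E] [FiniteDimensional ℝ E]
  {H : Type*} [TopologicalSpace H] {I : ModelWithCorners ℝ E H} [I.Boundaryless]
  {M : Type*} [TopologicalSpace M] [ChartedSpace H M] [IsManifold I ∞ M]
  {g : ContMDiffRiemannianMetric I ∞ E (fun x : M ↦ TangentSpace I x)}
  {cov : CovariantDerivative I E (TangentSpace I : M → Type _)}

/-- Skewness moves the zero into a linear slot of `g`, so multilinearity of the curvature is not
needed. -/
theorem IsLeviCivita.curvature_zero_right (hcov : IsLeviCivita g.inner cov) (x : M)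
    (a b : TangentSpace I x) : curvature cov x a b 0 = 0 :=
  metric_ext g fun c ↦ by
    rw [hcov.metric_curvature_skew, map_zero, map_zero, zero_apply, neg_zero]

theorem IsLeviCivita.curvature_zero_left (hcov : IsLeviCivita g.inner cov) (x : M)
    (b c : TangentSpace I x) : curvature cov x 0 b c = 0 :=
  metric_ext g fun d ↦ by
    rw [hcov.metric_curvature_pair, hcov.curvature_zero_right, map_zero, zero_apply, zero_apply]

theorem IsLeviCivita.curvature_zero_middle (hcov : IsLeviCivita g.inner cov) (x : M)
    (a c : TangentSpace I x) : curvature cov x a 0 c = 0 := by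
  rw [curvature_swap, hcov.curvature_zero_left, neg_zero]

end CurvatureZero

/-! ### Solving for the two components of the connection on `TM`. -/

section LeviCivitaOfLifts

variable {E : Type*} [NormedAddCommGroup E] [NormedSpace ℝ E] [FiniteDimensional ℝ E]
  {H : Type*} [TopologicalSpace H] {I : ModelWithCorners ℝ E H} [I.Boundaryless]
  {M : Type*} [TopologicalSpace M] [ChartedSpace H M] [IsManifold I ∞ M]
  {g : ContMDiffRiemannianMetric I ∞ E (fun x : M ↦ TangentSpace I x)}
  {cov : CovariantDerivative I E (TangentSpace I : M → Type _)} {m₁ m₂ m₃ : ℝ}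
  {covT : CovariantDerivative I.tangent (E × E) (TangentSpace I.tangent : TangentBundle I M → Type _)}

/-- The horizontal and vertical components of the Levi-Civita connection of the metric on `TM`,
paired with a horizontal vector and with a vertical vector. -/
theorem IsLeviCivita.metric_components_cov_fieldLift (hcov : IsLeviCivita g.inner cov)
    (hcovT : IsLeviCivita (metric g.inner cov m₁ m₂ m₃) covT)
    {X₁ Y₁ X₂ Y₂ : Π x : M, TangentSpace I x} {x : M}
    (hX₁ : C2FieldAt X₁ x) (hY₁ : C2FieldAt Y₁ x) (hX₂ : C2FieldAt X₂ x) (hY₂ : C2FieldAt Y₂ x)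
    (u : TangentSpace I x) {h v : TangentSpace I x}
    (hh : h = dproj I ⟨x, u⟩ (covT (fieldLift cov X₂ Y₂) ⟨x, u⟩ (fieldLift cov X₁ Y₁ ⟨x, u⟩)))
    (hv : v = connectionMap cov ⟨x, u⟩
      (covT (fieldLift cov X₂ Y₂) ⟨x, u⟩ (fieldLift cov X₁ Y₁ ⟨x, u⟩))) (c : TangentSpace I x) :
    2 * (m₁ * g.inner x h c + m₂ * g.inner x v c) =
        2 * (m₁ * g.inner x (cov X₂ x (X₁ x)) c + m₂ * g.inner x (cov Y₂ x (X₁ x)) c)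
          + 2 * m₂ * g.inner x (curvature cov x u (X₁ x) (X₂ x)) c
          + m₃ * (g.inner x (curvature cov x u (Y₁ x) (X₂ x)) c
            + g.inner x (curvature cov x u (Y₂ x) (X₁ x)) c) ∧
      2 * (m₂ * g.inner x h c + m₃ * g.inner x v c) =
        2 * (m₂ * g.inner x (cov X₂ x (X₁ x)) c + m₃ * g.inner x (cov Y₂ x (X₁ x)) c)
          - m₃ * g.inner x (curvature cov x (X₁ x) (X₂ x) u) c := by
  have key : ∀ p q : TangentSpace I x, _ := fun p q ↦
    hcov.koszul_fieldLift hcovT hX₁ hY₁ hX₂ hY₂ (c2FieldAt_extend p) (c2FieldAt_extend q) u hh hv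
  have hR {X Y Z : Π x : M, TangentSpace I x} (hX : C2FieldAt X x) (hY : C2FieldAt Y x)
      (hZ : C2FieldAt Z x) := (hcov.curvature_eq hX hY hZ).symm
  have hp (p : TangentSpace I x) : C2FieldAt (FiberBundle.extend E p) x := c2FieldAt_extend p
  have hswap (a b c d : TangentSpace I x) :
      g.inner x (curvature cov x a b c) d = -g.inner x (curvature cov x b a c) d := by
    rw [curvature_swap, map_neg, neg_apply]
  have hpair (a b c d : TangentSpace I x) :
      g.inner x (curvature cov x a b c) d = -g.inner x (curvature cov x d c a) b := by
    rw [hcov.metric_curvature_pair, hswap]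
  have hpair' (a b c d : TangentSpace I x) :
      g.inner x (curvature cov x a b c) d = g.inner x (curvature cov x d c b) a := by
    rw [hpair, hcov.metric_curvature_skew, neg_neg]
  constructor
  -- The test field has horizontal value `c` and vertical value `0`.
  · have h1 := key c 0
    rw [hR hX₁ hX₂ (hp c), hR hX₁ hX₂ (hp 0), hR hX₂ (hp c) hX₁, hR hX₂ (hp c) hY₁,
      hR (hp c) hX₁ hX₂, hR (hp c) hX₁ hY₂] at h1
    simp only [FiberBundle.extend_apply_self, hcov.curvature_zero_right, map_zero,
      zero_apply] at h1
    rw [hcov.metric_curvature_skew x (X₁ x) (X₂ x) c u, hpair (X₂ x) c (X₁ x) u,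
      hpair (X₂ x) c (Y₁ x) u, hpair' c (X₁ x) (X₂ x) u, hpair' c (X₁ x) (Y₂ x) u] at h1
    -- The Bianchi identity turns `R(u,X₁)X₂ + R(u,X₂)X₁ - R(X₁,X₂)u`, the coefficient of `m₂`, into
    -- `2 R(u,X₁)X₂`.
    have h2 := congrArg (fun w ↦ g.inner x w c) (hcov.curvature_cyclic x u (X₁ x) (X₂ x))
    simp only [map_add, add_apply, map_zero, zero_apply] at h2
    rw [hswap (X₂ x) u] at h2
    linear_combination h1 - m₂ * h2
  -- For a vertical test vector only the curvature in the bracket of the first two fields survives.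
  · have h1 := key 0 c
    rw [hR hX₁ hX₂ (hp c), hR hX₁ hX₂ (hp 0), hR hX₂ (hp 0) hX₁, hR hX₂ (hp 0) hY₁,
      hR (hp 0) hX₁ hX₂, hR (hp 0) hX₁ hY₂] at h1
    simp only [FiberBundle.extend_apply_self, hcov.curvature_zero_right, hcov.curvature_zero_left,
      hcov.curvature_zero_middle, map_zero, zero_apply] at h1
    rw [hcov.metric_curvature_skew x (X₁ x) (X₂ x) c u] at h1
    linear_combination h1

theorem IsLeviCivita.components_cov_fieldLift (hcov : IsLeviCivita g.inner cov)
    (hcovT : IsLeviCivita (metric g.inner cov m₁ m₂ m₃) covT) (hm : m₁ * m₃ - m₂ ^ 2 ≠ 0)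
    {X₁ Y₁ X₂ Y₂ : Π x : M, TangentSpace I x} {x : M}
    (hX₁ : C2FieldAt X₁ x) (hY₁ : C2FieldAt Y₁ x) (hX₂ : C2FieldAt X₂ x) (hY₂ : C2FieldAt Y₂ x)
    (u : TangentSpace I x) :
    dproj I ⟨x, u⟩ (covT (fieldLift cov X₂ Y₂) ⟨x, u⟩ (fieldLift cov X₁ Y₁ ⟨x, u⟩)) =
        cov X₂ x (X₁ x) + (1 / (m₁ * m₃ - m₂ ^ 2)) •
          ((m₂ * m₃) • curvature cov x u (X₁ x) (X₂ x)
            + (m₂ * m₃ / 2) • curvature cov x (X₁ x) (X₂ x) u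
            + (m₃ ^ 2 / 2) • (curvature cov x u (Y₁ x) (X₂ x) + curvature cov x u (Y₂ x) (X₁ x))) ∧
      connectionMap cov ⟨x, u⟩
          (covT (fieldLift cov X₂ Y₂) ⟨x, u⟩ (fieldLift cov X₁ Y₁ ⟨x, u⟩)) =
        cov Y₂ x (X₁ x) + (1 / (m₁ * m₃ - m₂ ^ 2)) •
          (-(m₂ ^ 2) • curvature cov x u (X₁ x) (X₂ x)
            - (m₁ * m₃ / 2) • curvature cov x (X₁ x) (X₂ x) u
            - (m₂ * m₃ / 2) •
              (curvature cov x u (Y₁ x) (X₂ x) + curvature cov x u (Y₂ x) (X₁ x))) := by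
  have key := hcov.metric_components_cov_fieldLift hcovT hX₁ hY₁ hX₂ hY₂ u rfl rfl
  constructor <;> refine metric_ext g fun c ↦ ?_ <;> obtain ⟨h1, h2⟩ := key c <;>
    simp only [map_add, map_sub, map_smul, add_apply, sub_apply, smul_apply, smul_eq_mul] <;>
    refine mul_left_cancel₀ (mul_ne_zero two_ne_zero hm) ?_ <;> field_simp
  -- Elimination in the system with rows `(m₁, m₂)` and `(m₂, m₃)`, whose determinant has been
  -- cleared beforehand.
  · linear_combination m₃ * h1 - m₂ * h2
  · linear_combination m₁ * h2 - m₂ * h1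

end LeviCivitaOfLifts

end TangentMetric

theorem mainTheorem1
    {E : Type*} [NormedAddCommGroup E] [NormedSpace ℝ E] [FiniteDimensional ℝ E]
    {H : Type*} [TopologicalSpace H] {I : ModelWithCorners ℝ E H} [I.Boundaryless]
    {M : Type*} [TopologicalSpace M] [ChartedSpace H M] [IsManifold I ∞ M]
    (g : ContMDiffRiemannianMetric I ∞ E (fun x : M ↦ TangentSpace I x))
    (cov : CovariantDerivative I E (TangentSpace I : M → Type _))
    (hcov : TangentMetric.IsLeviCivita g.inner cov)
    (m₁ m₂ m₃ : ℝ) (hm₁ : 0 < m₁) (hm₃ : 0 < m₃) (hm : 0 < m₁ * m₃ - m₂ ^ 2)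
    (covT : CovariantDerivative I.tangent (E × E)
      (TangentSpace I.tangent : TangentBundle I M → Type _))
    (hcovT : TangentMetric.IsLeviCivita (TangentMetric.metric g.inner cov m₁ m₂ m₃) covT)
    (X Y : Π x : M, TangentSpace I x)
    (hX : ContMDiff I I.tangent ∞ (fun x ↦ (⟨x, X x⟩ : TangentBundle I M)))
    (hY : ContMDiff I I.tangent ∞ (fun x ↦ (⟨x, Y x⟩ : TangentBundle I M)))
    (x : M) (u : TangentSpace I x) :
    TangentMetric.dproj I ⟨x, u⟩ (covT (TangentMetric.hlift cov Y) ⟨x, u⟩ (TangentMetric.hlift cov X ⟨x, u⟩)) =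
        cov Y x (X x) + (1 / (m₁ * m₃ - m₂ ^ 2)) •
          ((m₂ * m₃) • TangentMetric.curvature cov x u (X x) (Y x) + (m₂ * m₃ / 2) • TangentMetric.curvature cov x (X x) (Y x) u) ∧
    TangentMetric.connectionMap cov ⟨x, u⟩ (covT (TangentMetric.hlift cov Y) ⟨x, u⟩ (TangentMetric.hlift cov X ⟨x, u⟩)) =
        (1 / (m₁ * m₃ - m₂ ^ 2)) •
          (-(m₂ ^ 2) • TangentMetric.curvature cov x u (X x) (Y x) - (m₁ * m₃ / 2) • TangentMetric.curvature cov x (X x) (Y x) u) ∧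
    TangentMetric.dproj I ⟨x, u⟩ (covT (TangentMetric.vlift cov Y) ⟨x, u⟩ (TangentMetric.hlift cov X ⟨x, u⟩)) =
        (1 / (m₁ * m₃ - m₂ ^ 2)) • ((m₃ ^ 2 / 2) • TangentMetric.curvature cov x u (Y x) (X x)) ∧
    TangentMetric.connectionMap cov ⟨x, u⟩ (covT (TangentMetric.vlift cov Y) ⟨x, u⟩ (TangentMetric.hlift cov X ⟨x, u⟩)) =
        cov Y x (X x) - (1 / (m₁ * m₃ - m₂ ^ 2)) • ((m₂ * m₃ / 2) • TangentMetric.curvature cov x u (Y x) (X x)) ∧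
    TangentMetric.dproj I ⟨x, u⟩ (covT (TangentMetric.hlift cov Y) ⟨x, u⟩ (TangentMetric.vlift cov X ⟨x, u⟩)) =
        (1 / (m₁ * m₃ - m₂ ^ 2)) • ((m₃ ^ 2 / 2) • TangentMetric.curvature cov x u (X x) (Y x)) ∧
    TangentMetric.connectionMap cov ⟨x, u⟩ (covT (TangentMetric.hlift cov Y) ⟨x, u⟩ (TangentMetric.vlift cov X ⟨x, u⟩)) =
        -((1 / (m₁ * m₃ - m₂ ^ 2)) • ((m₂ * m₃ / 2) • TangentMetric.curvature cov x u (X x) (Y x))) ∧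
    TangentMetric.dproj I ⟨x, u⟩ (covT (TangentMetric.vlift cov Y) ⟨x, u⟩ (TangentMetric.vlift cov X ⟨x, u⟩)) = 0 ∧
    TangentMetric.connectionMap cov ⟨x, u⟩ (covT (TangentMetric.vlift cov Y) ⟨x, u⟩ (TangentMetric.vlift cov X ⟨x, u⟩)) = 0 := by
  have h0 : TangentMetric.C2FieldAt (I := I) (0 : Π y : M, TangentSpace I y) x :=
    ((contMDiff_zeroSection ℝ (TangentSpace I : M → Type _)) x).of_le ENat.LEInfty.out
  have hX' : TangentMetric.C2FieldAt X x := (hX x).of_le ENat.LEInfty.out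
  have hY' : TangentMetric.C2FieldAt Y x := (hY x).of_le ENat.LEInfty.out
  have hc : cov (0 : Π y : M, TangentSpace I y) x = 0 :=
    cov.isCovariantDerivativeOn.zero (Set.mem_univ x)
  have key := fun {X₁ Y₁ X₂ Y₂ : Π y : M, TangentSpace I y}
    (hX₁ : TangentMetric.C2FieldAt X₁ x) (hY₁ : TangentMetric.C2FieldAt Y₁ x)
    (hX₂ : TangentMetric.C2FieldAt X₂ x) (hY₂ : TangentMetric.C2FieldAt Y₂ x) ↦
    hcov.components_cov_fieldLift hcovT hm.ne' hX₁ hY₁ hX₂ hY₂ u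
  -- By definition `hlift cov X` is the lift of the pair `(X, 0)` and `vlift cov X` that of `(0,
  -- X)`. The four cases are horizontal-horizontal, horizontal-vertical, vertical-horizontal and
  -- vertical-vertical.
  have e1 := key hX' h0 hY' h0
  have e2 := key hX' h0 h0 hY'
  have e3 := key h0 hX' hY' h0
  have e4 := key h0 hX' h0 hY'
  simp only [hc, Pi.zero_apply, zero_apply, map_zero, hcov.curvature_zero_left,
    hcov.curvature_zero_middle, hcov.curvature_zero_right, smul_zero, add_zero, zero_add,
    sub_zero, zero_sub, smul_neg, ← sub_eq_add_neg] at e1 e2 e3 e4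
  exact ⟨e1.1, e1.2, e2.1, e2.2, e3.1, e3.2, e4.1, e4.2⟩
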